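/- Let $\Omega\subset\mathbb R^3$ be a bounded domain with smooth boundary, $a,b>0$, $p>3$, $\lambda\in\mathbb R$, $u_0\in H^2(\Omega)\cap H^1_0(\Omega)$, $u_1\in H^1_0(\Omega)$. For $0<T\le\infty$ let $H(T)=C([0,T);H^1_0(\Omega)\cap H^2(\Omega))\cap C^1([0,T);H^1_0(\Omega))\cap C^2([0,T);L^2(\Omega))$, and let $u\in H(T_{\max})$ be a solution, with maximal existence time $T_{\max}\in(0,\infty]$ (that is, $u$ has no extension to a solution in $H(T')$ with $T'>T_{\max}$), of $$u_{tt}-\Big(a\int_\Omega|\nabla u|^2\,dx+b\Big)\Delta u=\lambda u+|u|^{p-1}u\ \text{ in }(0,T_{\max})\times\Omega,\qquad u=0\ \text{ on }\partial\Omega,\qquad u(0)=u_0,\ u_t(0)=u_1 .$$ Put $$\lambda_1=\inf\{\|\nabla v\|_2^2: v\in H^1_0(\Omega),\ \|v\|_2=1\},\qquad S_{p+1}=\inf_{v\in H^1_0(\Omega)\setminus\{0\}}\frac{\|\nabla v\|_2^2}{\|v\|_{p+1}^2}\quad(p<5),$$ $$J(v)=\tfrac a4\|\nabla v\|_2^4+\tfrac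 b2\|\nabla v\|_2^2-\tfrac\lambda2\|v\|_2^2-\tfrac1{p+1}\|v\|_{p+1}^{p+1},\qquad I(v)=a\|\nabla v\|_2^4+b\|\nabla v\|_2^2-\lambda\|v\|_2^2-\|v\|_{p+1}^{p+1},$$ $$E(0)=\tfrac12\|u_1\|_2^2+J(u_0),\qquad h_0=\frac{(p-1)^2(\lambda-b\lambda_1)^2}{2(p-3)a\lambda_1^2},$$ and, for $3<p<5$, $d_p=\inf\{J(v): v\in H^1_0(\Omega)\setminus\{0\},\ I(v)=0\}$ and $W_p^-=\{v\in H^1_0(\Omega): J(v)<d_p,\ I(v)<0\}$. (a) If $\lambda\le b\lambda_1$, then $T_{\max}<\infty$ provided that one of the following holds: (a1) $E(0)<0$; (a2) $E(0)=0$ and $\int_\Omega u_0u_1\,dx>0$; (a3) $3<p<5$, $0<E(0)<d_p$, $\int_\Omega u_0u_1\,dx>0$ and $u_0\in W_p^-$; (a4) $E(0)>0$, $\int_\Omega u_0u_1\,dx>0$ and $\|u_0\|_2^4>\dfrac{4(p+1)}{(p-3)a\lambda_1^2}E(0)$. (b) If $\lambda>b\lambda_1$, then $T_{\max}<\infty$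 provided that one of the following holds: (b1) $E(0)<-h_0/(2p+2)$; (b2) $E(0)=-h_0/(2p+2)$ and $\int_\Omega u_0u_1\,dx>0$. (c) If $3<p<5$, $\lambda\le b\lambda_1$, $E(0)\le0$ and $\|\nabla u_0\|_2>0$, then $$\|\nabla u(t)\|_2\ge\Big[\tfrac{p+1}4\,a\,S_{p+1}^{(p+1)/2}\Big]^{1/(p-3)}\qquad\text{for all }t\in[0,T_{\max}).$$ -/

import Mathlib

open MeasureTheory Set Topology
open scoped ContDiff

noncomputable section

namespace Kirchhoff

/-- Physical space `ℝ³` with the Euclidean norm. -/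
abbrev E3 := EuclideanSpace ℝ (Fin 3)

/-- `∂Ω` is a smooth hypersurface with `Ω` locally on one side of it: near each boundary point,
`Ω` is the negativity set of a smooth function without critical points. -/
def HasSmoothBoundary (Ω : Set E3) : Prop :=
  ∀ x ∈ frontier Ω, ∃ U : Set E3, IsOpen U ∧ x ∈ U ∧ ∃ ρ : E3 → ℝ,
    ContDiffOn ℝ ∞ ρ U ∧ (∀ y ∈ U, fderiv ℝ ρ y ≠ 0) ∧ Ω ∩ U = {y | y ∈ U ∧ ρ y < 0}

/-- A bounded domain (nonempty connected open set) of `ℝ³` with smooth boundary. -/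
structure IsSmoothBoundedDomain (Ω : Set E3) : Prop where
  isOpen : IsOpen Ω
  isConnected : IsConnected Ω
  isBounded : Bornology.IsBounded Ω
  smoothBoundary : HasSmoothBoundary Ω

/-- `L²(Ω)`. -/
abbrev L2 (Ω : Set E3) := Lp ℝ 2 (volume.restrict Ω)

/-- `L²(Ω; ℝ³)`; its norm is `(∫_Ω |G|² dx)^{1/2}` with the Euclidean norm of `G(x)`. -/
abbrev L2Vec (Ω : Set E3) := Lp E3 2 (volume.restrict Ω)

/-- `φ ∈ C_c^∞(Ω)`. -/
structure IsTestFunction (Ω : Set E3) (φ : E3 → ℝ) : Prop where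
  smooth : ContDiff ℝ ∞ φ
  compact : HasCompactSupport φ
  support : tsupport φ ⊆ Ω

/-- `G` is the weak gradient of `f` on `Ω`. -/
def HasWeakGradient (Ω : Set E3) (f : E3 → ℝ) (G : E3 → E3) : Prop :=
  ∀ φ : E3 → ℝ, IsTestFunction Ω φ →
    ∫ x in Ω, f x • gradient φ x = - ∫ x in Ω, φ x • G x

/-- `H¹₀(Ω)`, the closure of `C_c^∞(Ω)` for the `H¹` norm. A function is recorded together with
its gradient, as an element `(f, ∇f)` of `L²(Ω) × L²(Ω; ℝ³)`; the norm inherited from the product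
is equivalent to the usual `H¹` norm. -/
def H10Submodule (Ω : Set E3) : Submodule ℝ (L2 Ω × L2Vec Ω) :=
  (Submodule.span ℝ {w : L2 Ω × L2Vec Ω | ∃ φ : E3 → ℝ, IsTestFunction Ω φ ∧
    w.1 =ᵐ[volume.restrict Ω] φ ∧ w.2 =ᵐ[volume.restrict Ω] gradient φ}).topologicalClosure

/-- The normed space `H¹₀(Ω)`. -/
abbrev H10 (Ω : Set E3) := ↥(H10Submodule Ω)

variable {Ω : Set E3}

/-- The function itself, as an element of `L²(Ω)`. -/
def H10.toL2 (v : H10 Ω) : L2 Ω := v.1.1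

/-- The gradient `∇v ∈ L²(Ω; ℝ³)`. -/
def H10.grad (v : H10 Ω) : L2Vec Ω := v.1.2

/-- `H²(Ω) ∩ H¹₀(Ω)`: elements `v` of `H¹₀(Ω)` all of whose first derivatives `∂ⱼv` have a weak
gradient `Hⱼ ∈ L²(Ω; ℝ³)`. The second derivatives are recorded, so the topology inherited from the
product is that of the `H²` norm. -/
def H2H10Set (Ω : Set E3) : Set (H10 Ω × (Fin 3 → L2Vec Ω)) :=
  {w | ∀ j : Fin 3, HasWeakGradient Ω (fun x => w.1.grad x j) (w.2 j)}

/-- The space `H²(Ω) ∩ H¹₀(Ω)` with the topology of the `H²` norm. -/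
abbrev H2H10 (Ω : Set E3) := ↥(H2H10Set Ω)

/-- The inclusion of `H²(Ω) ∩ H¹₀(Ω)` in `H¹₀(Ω)`. -/
def H2H10.toH10 (w : H2H10 Ω) : H10 Ω := w.1.1

/-- The Laplacian `Δw = ∑ⱼ ∂ⱼ∂ⱼw`. -/
def H2H10.laplacian (w : H2H10 Ω) (x : E3) : ℝ := ∑ j : Fin 3, w.1.2 j x j

/-- `λ₁`, the principal Dirichlet eigenvalue of `-Δ` on `Ω`:
`inf {‖∇v‖₂² : v ∈ H¹₀(Ω), ‖v‖₂ = 1}`. -/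
def lambda1 (Ω : Set E3) : ℝ :=
  sInf {r : ℝ | ∃ v : H10 Ω, ‖v.toL2‖ = 1 ∧ r = ‖v.grad‖ ^ 2}

/-- `‖v‖_q` for a finite exponent `q`. -/
def lqNorm (q : ℝ) (v : H10 Ω) : ℝ := (∫ x in Ω, |v.toL2 x| ^ q) ^ (1 / q)

/-- The Sobolev constant `S_q = inf {‖∇v‖₂² / ‖v‖_q² : v ∈ H¹₀(Ω) \ {0}}`. -/
def sobolevConst (Ω : Set E3) (q : ℝ) : ℝ :=
  sInf {r : ℝ | ∃ v : H10 Ω, v ≠ 0 ∧ r = ‖v.grad‖ ^ 2 / lqNorm q v ^ 2}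

/-- `J(v) = a/4 ‖∇v‖₂⁴ + b/2 ‖∇v‖₂² - λ/2 ‖v‖₂² - 1/(p+1) ‖v‖_{p+1}^{p+1}`. -/
def J (a b lam p : ℝ) (v : H10 Ω) : ℝ :=
  a / 4 * ‖v.grad‖ ^ 4 + b / 2 * ‖v.grad‖ ^ 2 - lam / 2 * ‖v.toL2‖ ^ 2
    - 1 / (p + 1) * ∫ x in Ω, |v.toL2 x| ^ (p + 1)

/-- The Nehari functional `I(v) = a ‖∇v‖₂⁴ + b ‖∇v‖₂² - λ ‖v‖₂² - ‖v‖_{p+1}^{p+1}`. -/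
def nehari (a b lam p : ℝ) (v : H10 Ω) : ℝ :=
  a * ‖v.grad‖ ^ 4 + b * ‖v.grad‖ ^ 2 - lam * ‖v.toL2‖ ^ 2 - ∫ x in Ω, |v.toL2 x| ^ (p + 1)

/-- The depth of the potential well, `d_p = inf {J(v) : v ∈ H¹₀(Ω) \ {0}, I(v) = 0}`. -/
def wellDepth (Ω : Set E3) (a b lam p : ℝ) : ℝ :=
  sInf {r : ℝ | ∃ v : H10 Ω, v ≠ 0 ∧ nehari a b lam p v = 0 ∧ r = J a b lam p v}

/-- The unstable set `W_p⁻ = {v ∈ H¹₀(Ω) : J(v) < d_p, I(v) < 0}`. -/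
def unstableSet (Ω : Set E3) (a b lam p : ℝ) : Set (H10 Ω) :=
  {v | J a b lam p v < wellDepth Ω a b lam p ∧ nehari a b lam p v < 0}

/-- The initial energy `E(0) = 1/2 ‖u₁‖₂² + J(u₀)`. -/
def initialEnergy (a b lam p : ℝ) (u₀ u₁ : H10 Ω) : ℝ :=
  1 / 2 * ‖u₁.toL2‖ ^ 2 + J a b lam p u₀

/-- `h₀ = (p-1)² (λ - bλ₁)² / (2 (p-3) a λ₁²)`. -/
def h0 (Ω : Set E3) (a b lam p : ℝ) : ℝ :=
  (p - 1) ^ 2 * (lam - b * lambda1 Ω) ^ 2 / (2 * (p - 3) * a * lambda1 Ω ^ 2)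

/-- The time interval `[0, T)`, where `T = ∞` is allowed. -/
def timeInterval (T : EReal) : Set ℝ := {t | 0 ≤ t ∧ (t : EReal) < T}

/-- `u ∈ H(T) = C([0,T); H¹₀ ∩ H²) ∩ C¹([0,T); H¹₀) ∩ C²([0,T); L²)`; only the values of `u` on
`[0, T)` matter. -/
structure MemH (T : EReal) (u : ℝ → H2H10 Ω) : Prop where
  continuousOn_H2 : ContinuousOn u (timeInterval T)
  contDiffOn_H1 : ContDiffOn ℝ 1 (fun t => (u t).toH10) (timeInterval T)
  contDiffOn_L2 : ContDiffOn ℝ 2 (fun t => (u t).toH10.toL2) (timeInterval T)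

/-- `u_t(t) ∈ H¹₀(Ω)` (one-sided at `t = 0`). -/
def velocity (T : EReal) (u : ℝ → H2H10 Ω) (t : ℝ) : H10 Ω :=
  derivWithin (fun s => (u s).toH10) (timeInterval T) t

/-- `u_tt(t) ∈ L²(Ω)` (one-sided at `t = 0`). -/
def acceleration (T : EReal) (u : ℝ → H2H10 Ω) (t : ℝ) : L2 Ω :=
  iteratedDerivWithin 2 (fun s => (u s).toH10.toL2) (timeInterval T) t

/-- `u ∈ H(T)` solves
`u_tt - (a ∫_Ω |∇u|² dx + b) Δu = λ u + |u|^{p-1} u` on `(0,T) × Ω`, `u = 0` on `∂Ω`,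
`u(0) = u₀`, `u_t(0) = u₁`. The boundary condition is contained in `u(t) ∈ H¹₀(Ω)`. -/
structure IsSolution (a b lam p : ℝ) (u₀ : H2H10 Ω) (u₁ : H10 Ω) (T : EReal)
    (u : ℝ → H2H10 Ω) : Prop where
  pos : 0 < T
  mem : MemH T u
  equation : ∀ t ∈ timeInterval T, 0 < t → ∀ᵐ x ∂(volume.restrict Ω),
    acceleration T u t x - (a * ‖(u t).toH10.grad‖ ^ 2 + b) * (u t).laplacian x
      = lam * (u t).toH10.toL2 x
        + |(u t).toH10.toL2 x| ^ (p - 1) * (u t).toH10.toL2 x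
  init : u 0 = u₀
  init_vel : velocity T u 0 = u₁

/-- `u` is a solution on `[0, T)` and `T` is its maximal existence time: `u` has no extension to a
solution in `H(T')` with `T' > T`. -/
structure IsMaximalSolution (a b lam p : ℝ) (u₀ : H2H10 Ω) (u₁ : H10 Ω) (T : EReal)
    (u : ℝ → H2H10 Ω) : Prop where
  solution : IsSolution a b lam p u₀ u₁ T u
  maximal : ∀ (T' : EReal) (v : ℝ → H2H10 Ω), IsSolution a b lam p u₀ u₁ T' v →
    EqOn v u (timeInterval T) → T' ≤ T

end Kirchhoff

end

noncomputable section

namespace Kirchhoff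

open Filter Asymptotics
open scoped RealInnerProductSpace

/-! Blow-up is Levine's concavity method applied to `φ = ‖u‖₂²`, assuming `Tmax = ⊤`. Pairing the
equation with `u` gives `φ'' = 2‖u_t‖² - 2 I(u)`, and conservation of energy eliminates the source
integral: `φ'' = (p+3)‖u_t‖² + (excess(u) - 2(p+1)E(0))`, where `excess` involves only `‖∇u‖` and
`‖u‖`. If the bracket is nonnegative, Cauchy–Schwarz gives `φ φ'' ≥ ((p+3)/4) φ'²`. Then
`φ^(-(p-1)/4)` lies below a decreasing line once `φ' > 0`, which is impossible for all time
(`false_of_concavity`, `IsSolution.false_of_excess`).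

Each alternative is thus a way to bound `excess` below. For `λ ≤ bλ₁` it is nonnegative and
dominates a multiple of `‖u‖⁴`, which settles nonpositive energy and large data. In the unstable set
it is at least `2(p+1)d_p`. For `λ > bλ₁` it is at least `-h₀`. Strict energy inequalities leave a
gap that makes `φ'` positive eventually; otherwise `φ'(0) > 0` is assumed.

The lower bound on `‖∇u‖` is separate: nonpositive energy and the Sobolev quotient force `‖∇u‖` to
be zero or large, and continuity in time excludes a jump.

The energy identity holds without an upper bound on `p`: the equation itself places `|u|^{p-1}u` in
`C([0,T);L²)`, and convexity of `y ↦ |y|^{p+1}` replaces growth estimates in the chain rule. -/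

/-! ### Real-variable lemmas: concavity, convexity and the chain rule. -/

/-- A lower bound on the derivative bounds the increment from below. -/
theorem mul_sub_le_sub_of_hasDerivWithinAt {f f' : ℝ → ℝ} {c t₀ t : ℝ} (h0 : 0 ≤ t₀)
    (ht : t₀ ≤ t) (hf : ∀ s, 0 ≤ s → HasDerivWithinAt f (f' s) (Ici 0) s)
    (hc : ∀ s ∈ Ioo t₀ t, c ≤ f' s) : c * (t - t₀) ≤ f t - f t₀ := by
  have hd : ∀ s ∈ Ioo t₀ t, HasDerivAt f (f' s) s := fun s hs =>
    (hf s (h0.trans hs.1.le)).hasDerivAt (Ici_mem_nhds (h0.trans_lt hs.1))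
  refine (convex_Icc t₀ t).mul_sub_le_image_sub_of_le_deriv ?_ ?_ ?_ t₀ (left_mem_Icc.2 ht) t
    (right_mem_Icc.2 ht) ht
  · exact fun s hs => (hf s (h0.trans hs.1)).continuousWithinAt.mono
      fun r hr => h0.trans hr.1
  · rw [interior_Icc]
    exact fun s hs => (hd s hs).differentiableAt.differentiableWithinAt
  · rw [interior_Icc]
    intro s hs
    rw [(hd s hs).deriv]
    exact hc s hs

/-- Continuous induction on `[0, ∞)` for an open condition. -/
theorem forall_pos_of_forall_Ico {g : ℝ → ℝ} (hg : ContinuousOn g (Ici 0))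
    (h : ∀ t, 0 ≤ t → (∀ s ∈ Ico 0 t, 0 < g s) → 0 < g t) : ∀ t, 0 ≤ t → 0 < g t := by
  by_contra! hcon
  obtain ⟨t, ht, hgt⟩ := hcon
  set S : Set ℝ := Ici 0 ∩ g ⁻¹' Iic 0 with hS
  have hSc : IsClosed S := hg.preimage_isClosed_of_isClosed isClosed_Ici isClosed_Iic
  have hbdd : BddBelow S := ⟨0, fun s hs => hs.1⟩
  have hmem : sInf S ∈ S := hSc.csInf_mem ⟨t, ht, hgt⟩ hbdd
  refine absurd (h _ hmem.1 fun s hs => ?_) (not_lt.2 hmem.2)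
  by_contra! hle
  exact absurd (csInf_le hbdd ⟨hs.1, hle⟩) (not_le.2 hs.2)

/-- Levine's concavity argument: `φ φ'' ≥ (1 + α) φ'²` is incompatible with global existence once
`φ` and `φ'` are positive. -/
theorem false_of_concavity {φ ψ χ : ℝ → ℝ} {α t₀ : ℝ} (hα : 0 < α) (h0 : 0 ≤ t₀)
    (hφ : ∀ t, 0 ≤ t → HasDerivWithinAt φ (ψ t) (Ici 0) t)
    (hψ : ∀ t, 0 ≤ t → HasDerivWithinAt ψ (χ t) (Ici 0) t)
    (hχ : ∀ t, t₀ ≤ t → 0 ≤ χ t)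
    (hc : ∀ t, t₀ ≤ t → (1 + α) * ψ t ^ 2 ≤ φ t * χ t)
    (hφ₀ : 0 < φ t₀) (hψ₀ : 0 < ψ t₀) : False := by
  have hψpos : ∀ t, t₀ ≤ t → 0 < ψ t := fun t ht => by
    have := mul_sub_le_sub_of_hasDerivWithinAt h0 ht hψ (c := 0) fun s hs => hχ s hs.1.le
    linarith
  have hφpos : ∀ t, t₀ ≤ t → 0 < φ t := fun t ht => by
    have := mul_sub_le_sub_of_hasDerivWithinAt h0 ht hφ (c := 0) fun s hs => (hψpos s hs.1.le).le
    linarith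
  have hsub : Ici t₀ ⊆ Ici (0 : ℝ) := Ici_subset_Ici.2 h0
  -- Up to the factor `-α` this is the derivative of `φ^(-α)`; hypothesis `hc` says exactly that it
  -- is nondecreasing.
  set q : ℝ → ℝ := fun t => ψ t * φ t ^ (-(1 + α)) with hq
  have hqd : ∀ t, t₀ < t → HasDerivAt q
      (χ t * φ t ^ (-(1 + α)) + ψ t * (ψ t * (-(1 + α)) * φ t ^ (-(1 + α) - 1))) t := by
    intro t ht
    have hn : Ici (0 : ℝ) ∈ 𝓝 t := Ici_mem_nhds (h0.trans_lt ht)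
    exact ((hψ t (h0.trans ht.le)).hasDerivAt hn).mul
      (((hφ t (h0.trans ht.le)).hasDerivAt hn).rpow_const (Or.inl (hφpos t ht.le).ne'))
  have hqc : ContinuousOn q (Ici t₀) := by
    intro t ht
    exact ((hψ t (h0.trans ht)).continuousWithinAt.mono hsub).mul
      (((hφ t (h0.trans ht)).continuousWithinAt.mono hsub).rpow_const (Or.inl (hφpos t ht).ne'))
  have hqmono : MonotoneOn q (Ici t₀) := by
    refine monotoneOn_of_deriv_nonneg (convex_Ici t₀) hqc ?_ ?_
    · rw [interior_Ici]
      exact fun t ht => (hqd t ht).differentiableAt.differentiableWithinAt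
    · rw [interior_Ici]
      intro t ht
      rw [(hqd t ht).deriv]
      have hp := hφpos t (le_of_lt ht)
      have h1 : φ t ^ (-(1 + α)) = φ t ^ (-(1 + α) - 1) * φ t := by
        rw [← Real.rpow_add_one hp.ne']; congr 1; ring
      rw [h1]
      have h2 := hc t (le_of_lt ht)
      have h3 : 0 < φ t ^ (-(1 + α) - 1) := Real.rpow_pos_of_pos hp _
      nlinarith [mul_le_mul_of_nonneg_left h2 h3.le]
  have hq₀ : 0 < q t₀ := mul_pos hψ₀ (Real.rpow_pos_of_pos hφ₀ _)
  have hd : ∀ t, t₀ < t → HasDerivAt (fun t => φ t ^ (-α)) (-α * q t) t := by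
    intro t ht
    have hn : Ici (0 : ℝ) ∈ 𝓝 t := Ici_mem_nhds (h0.trans_lt ht)
    convert ((hφ t (h0.trans ht.le)).hasDerivAt hn).rpow_const (p := -α)
      (Or.inl (hφpos t ht.le).ne') using 1
    simp only [hq]
    rw [show -(1 + α) = -α - 1 by ring]
    ring
  -- The time at which the line through `φ(t₀)^(-α)` with slope `-α q(t₀)` reaches zero.
  set t₁ := t₀ + φ t₀ ^ (-α) / (α * q t₀) with ht₁
  have hpα : 0 < φ t₀ ^ (-α) := Real.rpow_pos_of_pos hφ₀ _
  have hlt : t₀ ≤ t₁ := by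
    have : 0 < φ t₀ ^ (-α) / (α * q t₀) := by positivity
    linarith
  have key := (convex_Icc t₀ t₁).image_sub_le_mul_sub_of_deriv_le
    (f := fun t => φ t ^ (-α)) (C := -(α * q t₀)) ?_ ?_ ?_ t₀ (left_mem_Icc.2 hlt) t₁
    (right_mem_Icc.2 hlt) hlt
  · have hpos : 0 < φ t₁ ^ (-α) := Real.rpow_pos_of_pos (hφpos t₁ hlt) _
    have : α * q t₀ * (t₁ - t₀) = φ t₀ ^ (-α) := by
      rw [ht₁, add_sub_cancel_left]; field_simp
    linarith
  · intro t ht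
    exact (((hφ t (h0.trans ht.1)).continuousWithinAt.mono hsub).mono
      Icc_subset_Ici_self).rpow_const (Or.inl (hφpos t ht.1).ne')
  · rw [interior_Icc]
    exact fun t ht => (hd t ht.1).differentiableAt.differentiableWithinAt
  · rw [interior_Icc]
    intro t ht
    rw [(hd t ht.1).deriv]
    have := hqmono self_mem_Ici ht.1.le ht.1.le
    nlinarith

/-- `y ↦ |y|^{p+1}` lies above its tangent lines. -/
theorem tangent_le_abs_rpow {p : ℝ} (hp : 0 < p) (x y : ℝ) :
    (p + 1) * (|x| ^ (p - 1) * x * (y - x)) ≤ |y| ^ (p + 1) - |x| ^ (p + 1) := by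
  rcases eq_or_ne x 0 with rfl | hx
  · have : 0 ≤ |y| ^ (p + 1) := by positivity
    simpa [Real.zero_rpow (show p + 1 ≠ 0 by linarith)] using this
  have hx' : 0 < |x| := abs_pos.2 hx
  have hyoung := Real.young_inequality_of_nonneg (a := |x| ^ p) (b := |y|) (p := (p + 1) / p)
    (q := p + 1) (by positivity) (abs_nonneg y)
    ⟨by field_simp, by positivity, by positivity⟩
  rw [← Real.rpow_mul hx'.le, show p * ((p + 1) / p) = p + 1 by field_simp] at hyoung
  have h1 : |x| ^ (p - 1) * x * y ≤ |x| ^ p * |y| := by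
    calc |x| ^ (p - 1) * x * y ≤ |(|x| ^ (p - 1) * x * y)| := le_abs_self _
      _ = |x| ^ (p - 1) * |x| * |y| := by
        rw [abs_mul, abs_mul, abs_of_nonneg (Real.rpow_nonneg hx'.le _)]
      _ = |x| ^ p * |y| := by rw [← Real.rpow_add_one hx'.ne', sub_add_cancel]
  have h2 : |x| ^ (p - 1) * x * x = |x| ^ (p + 1) := by
    rw [mul_assoc, ← abs_mul_abs_self x, ← mul_assoc, ← Real.rpow_add_one hx'.ne',
      ← Real.rpow_add_one hx'.ne', sub_add_cancel]
  have h3 : (p + 1) * (|x| ^ (p + 1) / ((p + 1) / p) + |y| ^ (p + 1) / (p + 1))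
      = p * |x| ^ (p + 1) + |y| ^ (p + 1) := by field_simp
  have h4 : (p + 1) * (|x| ^ (p - 1) * x * (y - x))
      = (p + 1) * (|x| ^ (p - 1) * x * y) - (p + 1) * |x| ^ (p + 1) := by rw [← h2]; ring
  rw [h4]
  nlinarith [mul_le_mul_of_nonneg_left (h1.trans hyoung) (show 0 ≤ p + 1 by linarith)]

/-- Chain rule for a convex potential `P` along a differentiable curve `U`, when its gradient `N`
is continuous along the curve. -/
theorem hasDerivWithinAt_of_subgradient {H : Type*} [NormedAddCommGroup H] [InnerProductSpace ℝ H]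
    {P : ℝ → ℝ} {U N : ℝ → H} {V : H} {D : Set ℝ} {t q : ℝ} (ht : t ∈ D) (hq : 0 ≤ q)
    (hU : HasDerivWithinAt U V D t) (hN : ContinuousWithinAt N D t)
    (h : ∀ r ∈ D, ∀ s ∈ D, q * ⟪N r, U s - U r⟫ ≤ P s - P r) :
    HasDerivWithinAt P (q * ⟪N t, V⟫) D t := by
  have h1 : HasDerivWithinAt (fun s => q * ⟪N t, U s⟫) (q * ⟪N t, V⟫) D t := by
    have := ((hasDerivWithinAt_const t D (N t)).inner ℝ hU).const_mul q
    simpa using this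
  -- The subgradient inequality at `t` makes the increment of this remainder nonnegative. The one at
  -- `s` bounds it by `q ‖N s - N t‖ ‖U s - U t‖`, which is `o(s - t)`.
  have h2 : HasDerivWithinAt (fun s => P s - q * ⟪N t, U s⟫) 0 D t := by
    rw [hasDerivWithinAt_iff_isLittleO]
    have hO : (fun s => U s - U t) =O[𝓝[D] t] fun s => s - t :=
      hU.hasFDerivWithinAt.isBigO_sub
    have ho : (fun s => N s - N t) =o[𝓝[D] t] fun _ => (1 : ℝ) := by
      rw [isLittleO_one_iff]
      simpa using Tendsto.sub_const (show Tendsto N (𝓝[D] t) (𝓝 (N t)) from hN) (N t)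
    have hprod : (fun s => ‖N s - N t‖ * ‖U s - U t‖) =o[𝓝[D] t] fun s => s - t := by
      simpa using ho.norm_left.mul_isBigO hO.norm_left
    refine IsBigO.trans_isLittleO (IsBigO.of_bound q ?_) hprod
    filter_upwards [self_mem_nhdsWithin] with s hs
    have e1 := h t ht s hs
    have e2 := h s hs t ht
    have e3 : ⟪N s, U t - U s⟫ = -⟪N t, U s - U t⟫ - ⟪N s - N t, U s - U t⟫ := by
      rw [← neg_sub (U s) (U t), inner_neg_right, inner_sub_left]; ring
    have e4 := real_inner_le_norm (N s - N t) (U s - U t)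
    have e5 : ⟪N t, U s - U t⟫ = ⟪N t, U s⟫ - ⟪N t, U t⟫ := inner_sub_right _ _ _
    rw [smul_zero, sub_zero, Real.norm_eq_abs, Real.norm_of_nonneg (by positivity), abs_le]
    have e6 := mul_le_mul_of_nonneg_left e4 hq
    have e7 : 0 ≤ q * (‖N s - N t‖ * ‖U s - U t‖) := by positivity
    rw [e3] at e2
    rw [e5] at e1 e2
    constructor <;> nlinarith
  simpa [Pi.add_def] using h2.add h1

/-! ### Density arguments in `H¹₀(Ω)`, Poincaré's inequality and `λ₁`. -/

variable {Ω : Set E3}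

/-- `H10.toL2` as a continuous linear map. -/
def toL2L (Ω : Set E3) : H10 Ω →L[ℝ] L2 Ω :=
  (ContinuousLinearMap.fst ℝ (L2 Ω) (L2Vec Ω)).comp (H10Submodule Ω).subtypeL

/-- `H10.grad` as a continuous linear map. -/
def gradL (Ω : Set E3) : H10 Ω →L[ℝ] L2Vec Ω :=
  (ContinuousLinearMap.snd ℝ (L2 Ω) (L2Vec Ω)).comp (H10Submodule Ω).subtypeL

theorem toL2_smul (c : ℝ) (v : H10 Ω) : (c • v).toL2 = c • v.toL2 := rfl

theorem grad_smul (c : ℝ) (v : H10 Ω) : (c • v).grad = c • v.grad := rfl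

/-- Pairs `(φ, ∇φ)` of a test function and its gradient. -/
def testPairs (Ω : Set E3) : Set (L2 Ω × L2Vec Ω) :=
  {w | ∃ φ : E3 → ℝ, IsTestFunction Ω φ ∧
    w.1 =ᵐ[volume.restrict Ω] φ ∧ w.2 =ᵐ[volume.restrict Ω] gradient φ}

theorem IsTestFunction.differentiableAt {φ : E3 → ℝ} (h : IsTestFunction Ω φ) (x : E3) :
    DifferentiableAt ℝ φ x :=
  h.smooth.differentiable (by simp) x

theorem IsTestFunction.add {φ ψ : E3 → ℝ} (h : IsTestFunction Ω φ) (k : IsTestFunction Ω ψ) :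
    IsTestFunction Ω (φ + ψ) :=
  ⟨h.smooth.add k.smooth, h.compact.add k.compact,
    (tsupport_add φ ψ).trans (union_subset h.support k.support)⟩

theorem IsTestFunction.const_smul {φ : E3 → ℝ} (h : IsTestFunction Ω φ) (c : ℝ) :
    IsTestFunction Ω (c • φ) :=
  ⟨h.smooth.const_smul c, h.compact.smul_left (f := fun _ => c),
    (tsupport_smul_subset_right (fun _ => c) φ).trans h.support⟩

theorem IsTestFunction.zero : IsTestFunction Ω 0 :=
  ⟨contDiff_const, HasCompactSupport.zero, by simp [tsupport]⟩

theorem gradient_add_test {φ ψ : E3 → ℝ} (h : IsTestFunction Ω φ) (k : IsTestFunction Ω ψ) :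
    gradient (φ + ψ) = gradient φ + gradient ψ := by
  funext x
  simp [gradient, fderiv_add (h.differentiableAt x) (k.differentiableAt x)]

theorem gradient_smul_test {φ : E3 → ℝ} (h : IsTestFunction Ω φ) (c : ℝ) :
    gradient (c • φ) = c • gradient φ := by
  funext x
  simp [gradient, fderiv_const_smul (h.differentiableAt x)]

/-- Test functions already form a vector space, so the span adds nothing and a closed property need
only be checked on single pairs. -/
theorem mem_testPairs_of_mem_span {w : L2 Ω × L2Vec Ω}
    (hw : w ∈ Submodule.span ℝ (testPairs Ω)) : w ∈ testPairs Ω := by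
  induction hw using Submodule.span_induction with
  | mem x hx => exact hx
  | zero =>
    refine ⟨0, IsTestFunction.zero, Lp.coeFn_zero _ _ _, ?_⟩
    have : gradient (0 : E3 → ℝ) = 0 := by funext x; simp [gradient]
    rw [this]
    exact Lp.coeFn_zero _ _ _
  | add x y _ _ hx hy =>
    obtain ⟨φ, h, h1, h2⟩ := hx
    obtain ⟨ψ, k, k1, k2⟩ := hy
    refine ⟨φ + ψ, h.add k, (Lp.coeFn_add _ _).trans (h1.add k1), ?_⟩
    rw [gradient_add_test h k]
    exact (Lp.coeFn_add _ _).trans (h2.add k2)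
  | smul c x _ hx =>
    obtain ⟨φ, h, h1, h2⟩ := hx
    refine ⟨c • φ, h.const_smul c, (Lp.coeFn_smul _ _).trans (h1.const_smul c), ?_⟩
    rw [gradient_smul_test h]
    exact (Lp.coeFn_smul _ _).trans (h2.const_smul c)

/-- A closed property of pairs that holds for test functions holds on `H¹₀(Ω)`. -/
theorem H10.induction_closed {P : Set (L2 Ω × L2Vec Ω)} (hP : IsClosed P)
    (h : testPairs Ω ⊆ P) (v : H10 Ω) : v.1 ∈ P := by
  have hv : v.1 ∈ closure (Submodule.span ℝ (testPairs Ω) : Set (L2 Ω × L2Vec Ω)) := v.2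
  exact closure_minimal (fun w hw => h (mem_testPairs_of_mem_span hw)) hP hv

/-- Poincaré's inequality. -/
theorem exists_poincare (hΩ : Bornology.IsBounded Ω) :
    ∃ C : ℝ, 0 < C ∧ ∀ v : H10 Ω, ‖v.toL2‖ ≤ C * ‖v.grad‖ := by
  set K := eLpNormLESNormFDerivOfLeConst ℝ (volume : Measure E3) Ω 2 2
  -- The added `1` only ensures a positive constant.
  refine ⟨K + 1, by positivity, fun v => ?_⟩
  refine H10.induction_closed (P := {w | ‖w.1‖ ≤ (K + 1) * ‖w.2‖})
    (isClosed_le (by fun_prop) (by fun_prop)) ?_ v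
  rintro ⟨f, g⟩ ⟨φ, h, hf, hg⟩
  have hsupp : Function.support φ ⊆ Ω := (subset_tsupport φ).trans h.support
  have hgsupp : Function.support (gradient φ) ⊆ Ω := by
    refine subset_trans (fun x hx => ?_) ((support_fderiv_subset ℝ (f := φ)).trans h.support)
    rw [Function.mem_support] at hx ⊢
    intro h0
    exact hx (by simp [gradient, h0])
  have key := eLpNorm_le_eLpNorm_fderiv (volume : Measure E3) (h.smooth.of_le (by simp)) hsupp
    (p := 2) (by norm_num) (by simp; norm_num) hΩ
  have e1 : eLpNorm (fderiv ℝ φ) 2 (volume : Measure E3) = eLpNorm (gradient φ) 2 volume :=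
    eLpNorm_congr_norm_ae (Eventually.of_forall fun x => by simp [gradient])
  have key2 : eLpNorm f 2 (volume.restrict Ω) ≤ K * eLpNorm g 2 (volume.restrict Ω) := by
    rw [eLpNorm_congr_ae hf, eLpNorm_congr_ae hg,
      eLpNorm_restrict_eq_of_support_subset hsupp, eLpNorm_restrict_eq_of_support_subset hgsupp,
      ← e1]
    exact key
  have key3 : ‖f‖ ≤ K * ‖g‖ := by
    rw [Lp.norm_def, Lp.norm_def]
    have := ENNReal.toReal_mono (ENNReal.mul_ne_top ENNReal.coe_ne_top (Lp.eLpNorm_ne_top g)) key2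
    rwa [ENNReal.toReal_mul, ENNReal.coe_toReal] at this
  have : 0 ≤ ‖g‖ := norm_nonneg g
  change ‖f‖ ≤ (K + 1) * ‖g‖
  linarith

theorem lambda1_nonneg : 0 ≤ lambda1 Ω :=
  Real.sInf_nonneg (by rintro r ⟨v, -, rfl⟩; positivity)

/-- `λ₁ ‖v‖₂² ≤ ‖∇v‖₂²`. -/
theorem lambda1_mul_le (v : H10 Ω) : lambda1 Ω * ‖v.toL2‖ ^ 2 ≤ ‖v.grad‖ ^ 2 := by
  rcases eq_or_ne ‖v.toL2‖ 0 with h | h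
  · rw [h]; simp
  have hb : BddBelow {r : ℝ | ∃ v : H10 Ω, ‖v.toL2‖ = 1 ∧ r = ‖v.grad‖ ^ 2} :=
    ⟨0, by rintro r ⟨v, -, rfl⟩; positivity⟩
  have hle : lambda1 Ω ≤ (‖v.toL2‖⁻¹ * ‖v.grad‖) ^ 2 := by
    refine csInf_le hb ⟨‖v.toL2‖⁻¹ • v, ?_, ?_⟩
    · rw [toL2_smul, norm_smul, norm_inv, norm_norm, inv_mul_cancel₀ h]
    · rw [grad_smul, norm_smul, norm_inv, norm_norm]
  have := mul_le_mul_of_nonneg_right hle (sq_nonneg ‖v.toL2‖)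
  rwa [← mul_pow, mul_right_comm, inv_mul_cancel₀ h, one_mul] at this

/-- Poincaré bounds the infimum below by `C⁻²`. The nonzero `v` makes the set of competitors
nonempty; over the empty set `sInf` would be `0`. -/
theorem lambda1_pos (hΩ : Bornology.IsBounded Ω) {v : H10 Ω} (hv : v.toL2 ≠ 0) :
    0 < lambda1 Ω := by
  obtain ⟨C, hC, h⟩ := exists_poincare hΩ
  have hv' : ‖v.toL2‖ ≠ 0 := norm_ne_zero_iff.2 hv
  refine lt_of_lt_of_le (show 0 < (C⁻¹) ^ 2 by positivity) (le_csInf ?_ ?_)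
  · exact ⟨_, ‖v.toL2‖⁻¹ • v,
      by rw [toL2_smul, norm_smul, norm_inv, norm_norm, inv_mul_cancel₀ hv'], rfl⟩
  · rintro r ⟨w, hw, rfl⟩
    have h1 := h w
    rw [hw] at h1
    gcongr
    rwa [inv_le_iff_one_le_mul₀' hC]

/-! ### The Laplacian in `L²(Ω)` and Green's formula. -/

/-- The `j`-th component of an `L²` vector field. -/
def coordL (Ω : Set E3) (j : Fin 3) : L2Vec Ω →L[ℝ] L2 Ω :=
  (EuclideanSpace.proj j : E3 →L[ℝ] ℝ).compLpL 2 (volume.restrict Ω)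

theorem coordL_ae (j : Fin 3) (G : L2Vec Ω) :
    coordL Ω j G =ᵐ[volume.restrict Ω] fun x => G x j :=
  ContinuousLinearMap.coeFn_compLpL _ _

/-- The trace `∑ⱼ Hⱼⱼ` of the matrix of second derivatives. -/
def traceL (Ω : Set E3) : (Fin 3 → L2Vec Ω) →L[ℝ] L2 Ω :=
  ∑ j, (coordL Ω j).comp (ContinuousLinearMap.proj j)

/-- `Δw` as an element of `L²(Ω)`. -/
def lapL2 (w : H2H10 Ω) : L2 Ω := traceL Ω w.1.2

theorem continuous_lapL2 : Continuous (lapL2 : H2H10 Ω → L2 Ω) :=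
  (traceL Ω).continuous.comp (continuous_snd.comp continuous_subtype_val)

theorem lapL2_apply (w : H2H10 Ω) : lapL2 w = ∑ j, coordL Ω j (w.1.2 j) := by
  simp [lapL2, traceL]

theorem lapL2_ae (w : H2H10 Ω) : lapL2 w =ᵐ[volume.restrict Ω] w.laplacian := by
  have h := eventually_all.2 fun j => coordL_ae j (w.1.2 j)
  rw [lapL2_apply]
  filter_upwards [h, Lp.coeFn_finsetSum Finset.univ fun j => coordL Ω j (w.1.2 j)] with x hx hs
  rw [hs, Finset.sum_apply, H2H10.laplacian]
  exact Finset.sum_congr rfl fun j _ => hx j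

theorem inner_eq_sum_coordL (G G' : L2Vec Ω) : ⟪G, G'⟫ = ∑ j, ⟪coordL Ω j G, coordL Ω j G'⟫ := by
  simp only [L2.inner_def]
  rw [← integral_finsetSum _ fun j _ => L2.integrable_inner (𝕜 := ℝ) _ _]
  refine integral_congr_ae ?_
  filter_upwards [eventually_all.2 fun j => coordL_ae j G,
    eventually_all.2 fun j => coordL_ae j G'] with x h1 h2
  rw [PiLp.inner_apply]
  exact Finset.sum_congr rfl fun j _ => by rw [h1, h2]

/-- Green's formula `∫ ∇w · ∇v = -∫ Δw v`. -/
theorem inner_grad_eq (w : H2H10 Ω) (v : H10 Ω) :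
    ⟪w.toH10.grad, v.grad⟫ = -⟪lapL2 w, v.toL2⟫ := by
  refine H10.induction_closed (P := {z | ⟪w.toH10.grad, z.2⟫ = -⟪lapL2 w, z.1⟫})
    (isClosed_eq (by fun_prop) (by fun_prop)) ?_ v
  rintro ⟨f, g⟩ ⟨φ, h, hf, hg⟩
  change ⟪w.toH10.grad, g⟫ = -⟪lapL2 w, f⟫
  rw [inner_eq_sum_coordL, lapL2_apply, sum_inner, ← Finset.sum_neg_distrib]
  refine Finset.sum_congr rfl fun j _ => ?_
  -- The weak-gradient identity for `∂ⱼw` is vector-valued; only its `j`-th component enters the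
  -- trace.
  have hw : (EuclideanSpace.proj j : E3 →L[ℝ] ℝ) (∫ x in Ω, w.toH10.grad x j • gradient φ x)
      = (EuclideanSpace.proj j : E3 →L[ℝ] ℝ) (-∫ x in Ω, φ x • w.1.2 j x) :=
    congrArg _ (w.2 j φ h)
  have hG := coordL_ae j w.toH10.grad
  have hi1 : Integrable (fun x => w.toH10.grad x j • gradient φ x) (volume.restrict Ω) := by
    have := memLp_one_iff_integrable.1
      ((Lp.memLp g).smul (Lp.memLp (coordL Ω j w.toH10.grad)) (r := 1))
    refine this.congr ?_
    filter_upwards [hG, hg] with x h1 h2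
    simp only [Pi.smul_apply', h1, h2]
  have hi2 : Integrable (fun x => φ x • w.1.2 j x) (volume.restrict Ω) := by
    have := memLp_one_iff_integrable.1
      ((Lp.memLp (w.1.2 j)).smul (Lp.memLp f) (r := 1))
    refine this.congr ?_
    filter_upwards [hf] with x h1
    simp only [Pi.smul_apply', h1]
  rw [map_neg, ← ContinuousLinearMap.integral_comp_comm _ hi1,
    ← ContinuousLinearMap.integral_comp_comm _ hi2] at hw
  rw [L2.inner_def, L2.inner_def]
  refine Eq.trans (integral_congr_ae ?_) (hw.trans (congrArg _ (integral_congr_ae ?_)))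
  · filter_upwards [hG, hg, coordL_ae j g] with x h1 h2 h3
    rw [h1, h3, h2]
    simp [mul_comm]
  · filter_upwards [hf, coordL_ae j (w.1.2 j)] with x h1 h2
    rw [h1, h2]
    simp

/-! ### The time interval. -/

theorem timeInterval_top : timeInterval ⊤ = Ici 0 := by
  ext t; simp [timeInterval, EReal.coe_lt_top]

theorem timeInterval_ordConnected (T : EReal) : (timeInterval T).OrdConnected :=
  ⟨fun _ hx _ hy _ hz => ⟨hx.1.trans hz.1, (EReal.coe_le_coe_iff.2 hz.2).trans_lt hy.2⟩⟩

theorem exists_Icc_subset_timeInterval {T : EReal} (hT : 0 < T) :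
    ∃ ε : ℝ, 0 < ε ∧ Icc 0 ε ⊆ timeInterval T := by
  obtain ⟨ε, h1, h2⟩ := EReal.lt_iff_exists_real_btwn.1 hT
  exact ⟨ε, by exact_mod_cast h1, fun s hs => ⟨hs.1, (EReal.coe_le_coe_iff.2 hs.2).trans_lt h2⟩⟩

theorem zero_mem_timeInterval {T : EReal} (hT : 0 < T) : (0 : ℝ) ∈ timeInterval T :=
  ⟨le_rfl, by exact_mod_cast hT⟩

theorem timeInterval_uniqueDiffOn {T : EReal} (hT : 0 < T) : UniqueDiffOn ℝ (timeInterval T) := by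
  obtain ⟨ε, hε, h⟩ := exists_Icc_subset_timeInterval hT
  refine uniqueDiffOn_convex (timeInterval_ordConnected T).convex ⟨ε / 2, ?_⟩
  exact interior_mono h (by rw [interior_Icc]; constructor <;> linarith)

/-! ### The nonlinearity as an `L²` function. -/

theorem continuous_abs_rpow_mul {p : ℝ} (hp : 1 ≤ p) :
    Continuous fun x : ℝ => |x| ^ (p - 1) * x :=
  (continuous_abs.rpow_const fun _ => Or.inr (by linarith)).mul continuous_id

/-- The graph of a Nemytskii operator is closed in `Lᵖ`. -/
theorem ae_eq_comp_of_tendsto {α : Type*} [MeasurableSpace α] {μ : Measure α} {h : ℝ → ℝ}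
    (hh : Continuous h) {F N : ℕ → Lp ℝ 2 μ} {f n : Lp ℝ 2 μ} (hF : Tendsto F atTop (𝓝 f))
    (hN : Tendsto N atTop (𝓝 n)) (hFN : ∀ k, N k =ᵐ[μ] fun x => h (F k x)) :
    n =ᵐ[μ] fun x => h (f x) := by
  -- `L²` convergence gives a.e. convergence only along a subsequence, so two successive extractions
  -- are made.
  obtain ⟨σ, hσ, h1⟩ := (tendstoInMeasure_of_tendsto_Lp hF).exists_seq_tendsto_ae
  obtain ⟨τ, hτ, h2⟩ :=
    (tendstoInMeasure_of_tendsto_Lp (hN.comp hσ.tendsto_atTop)).exists_seq_tendsto_ae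
  filter_upwards [h1, h2, ae_all_iff.2 hFN] with x x1 x2 x3
  refine tendsto_nhds_unique x2 ?_
  simp only [Function.comp_apply, x3]
  exact (hh.tendsto _).comp (x1.comp hτ.tendsto_atTop)

theorem integral_abs_rpow_eq_inner {p : ℝ} (hp : 1 < p) {f n : L2 Ω}
    (h : n =ᵐ[volume.restrict Ω] fun x => |f x| ^ (p - 1) * f x) :
    (fun x => |f x| ^ (p + 1)) =ᵐ[volume.restrict Ω] fun x => ⟪n x, f x⟫ := by
  filter_upwards [h] with x hx
  rw [hx]
  rcases eq_or_ne (f x) 0 with h0 | h0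
  · simp [h0, Real.zero_rpow (show p + 1 ≠ 0 by linarith)]
  · have hpos : 0 < |f x| := abs_pos.2 h0
    simp only [RCLike.inner_apply, conj_trivial]
    rw [mul_comm, mul_assoc, ← abs_mul_abs_self (f x), ← mul_assoc,
      ← Real.rpow_add_one hpos.ne', ← Real.rpow_add_one hpos.ne', sub_add_cancel]

/-- The convexity inequality for `v ↦ ‖v‖_{p+1}^{p+1}`. -/
theorem subgradient_integral_abs_rpow {p : ℝ} (hp : 1 < p) {f n g m : L2 Ω}
    (h : n =ᵐ[volume.restrict Ω] fun x => |f x| ^ (p - 1) * f x)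
    (k : m =ᵐ[volume.restrict Ω] fun x => |g x| ^ (p - 1) * g x) :
    (p + 1) * ⟪n, g - f⟫ ≤ (∫ x in Ω, |g x| ^ (p + 1)) - ∫ x in Ω, |f x| ^ (p + 1) := by
  -- `|f|^{p+1}` is the product of the `L²` functions `n` and `f`, so no Sobolev embedding is
  -- needed.
  have hf : Integrable (fun x => |f x| ^ (p + 1)) (volume.restrict Ω) :=
    (L2.integrable_inner n f).congr (integral_abs_rpow_eq_inner hp h).symm
  have hg : Integrable (fun x => |g x| ^ (p + 1)) (volume.restrict Ω) :=
    (L2.integrable_inner m g).congr (integral_abs_rpow_eq_inner hp k).symm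
  rw [← integral_sub hg hf, L2.inner_def, ← integral_const_mul]
  refine integral_mono_ae ((L2.integrable_inner n (g - f)).const_mul _) (hg.sub hf) ?_
  filter_upwards [h, Lp.coeFn_sub g f] with x hx hs
  rw [hx, hs]
  refine le_trans (le_of_eq ?_) (tangent_le_abs_rpow (by linarith : 0 < p) (f x) (g x))
  simp [mul_comm]

/-! ### Energy conservation and the second derivative of `‖u‖²`. -/

/-- `u_tt - (a ‖∇u‖² + b) Δu - λ u`, as an element of `L²(Ω)`. -/
def source (a b lam : ℝ) (T : EReal) (u : ℝ → H2H10 Ω) (t : ℝ) : L2 Ω :=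
  acceleration T u t - (a * ‖(u t).toH10.grad‖ ^ 2 + b) • lapL2 (u t) - lam • (u t).toH10.toL2

/-- `E(t) = 1/2 ‖u_t‖² + J(u)`. -/
def energy (a b lam p : ℝ) (T : EReal) (u : ℝ → H2H10 Ω) (t : ℝ) : ℝ :=
  1 / 2 * ‖(velocity T u t).toL2‖ ^ 2 + J a b lam p (u t).toH10

namespace IsSolution

variable {a b lam p : ℝ} {u₀ : H2H10 Ω} {u₁ : H10 Ω} {T : EReal} {u : ℝ → H2H10 Ω}

theorem hasDerivWithinAt_toH10 (hu : IsSolution a b lam p u₀ u₁ T u) {t : ℝ}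
    (ht : t ∈ timeInterval T) :
    HasDerivWithinAt (fun s => (u s).toH10) (velocity T u t) (timeInterval T) t :=
  (hu.mem.contDiffOn_H1.differentiableOn (by simp) t ht).hasDerivWithinAt

theorem hasDerivWithinAt_toL2 (hu : IsSolution a b lam p u₀ u₁ T u) {t : ℝ}
    (ht : t ∈ timeInterval T) :
    HasDerivWithinAt (fun s => (u s).toH10.toL2) (velocity T u t).toL2 (timeInterval T) t :=
  (toL2L Ω).hasFDerivAt.comp_hasDerivWithinAt t (hu.hasDerivWithinAt_toH10 ht)

theorem hasDerivWithinAt_grad (hu : IsSolution a b lam p u₀ u₁ T u) {t : ℝ}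
    (ht : t ∈ timeInterval T) :
    HasDerivWithinAt (fun s => (u s).toH10.grad) (velocity T u t).grad (timeInterval T) t :=
  (gradL Ω).hasFDerivAt.comp_hasDerivWithinAt t (hu.hasDerivWithinAt_toH10 ht)

theorem derivWithin_toL2 (hu : IsSolution a b lam p u₀ u₁ T u) {t : ℝ}
    (ht : t ∈ timeInterval T) :
    derivWithin (fun s => (u s).toH10.toL2) (timeInterval T) t = (velocity T u t).toL2 :=
  (hu.hasDerivWithinAt_toL2 ht).derivWithin (timeInterval_uniqueDiffOn hu.pos t ht)

theorem contDiffOn_derivWithin (hu : IsSolution a b lam p u₀ u₁ T u) :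
    ContDiffOn ℝ 1 (derivWithin (fun s => (u s).toH10.toL2) (timeInterval T))
      (timeInterval T) :=
  ((contDiffOn_succ_iff_derivWithin (n := 1) (timeInterval_uniqueDiffOn hu.pos)).1
    (by simpa [one_add_one_eq_two] using hu.mem.contDiffOn_L2)).2.2

theorem acceleration_eq :
    acceleration T u = derivWithin (derivWithin (fun s => (u s).toH10.toL2) (timeInterval T))
      (timeInterval T) := by
  funext t
  rw [acceleration, iteratedDerivWithin_succ, iteratedDerivWithin_one]

theorem hasDerivWithinAt_velocity (hu : IsSolution a b lam p u₀ u₁ T u) {t : ℝ}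
    (ht : t ∈ timeInterval T) :
    HasDerivWithinAt (fun s => (velocity T u s).toL2) (acceleration T u t)
      (timeInterval T) t := by
  rw [acceleration_eq]
  exact ((hu.contDiffOn_derivWithin.differentiableOn (by simp) t ht).hasDerivWithinAt).congr
    (fun s hs => (hu.derivWithin_toL2 hs).symm) (hu.derivWithin_toL2 ht).symm

theorem continuousOn_acceleration (hu : IsSolution a b lam p u₀ u₁ T u) :
    ContinuousOn (acceleration T u) (timeInterval T) := by
  rw [acceleration_eq]
  exact hu.contDiffOn_derivWithin.continuousOn_derivWithin (timeInterval_uniqueDiffOn hu.pos)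
    (by simp)

theorem continuousOn_toL2 (hu : IsSolution a b lam p u₀ u₁ T u) :
    ContinuousOn (fun t => (u t).toH10.toL2) (timeInterval T) :=
  fun _ ht => (hu.hasDerivWithinAt_toL2 ht).continuousWithinAt

theorem continuousOn_grad (hu : IsSolution a b lam p u₀ u₁ T u) :
    ContinuousOn (fun t => (u t).toH10.grad) (timeInterval T) :=
  fun _ ht => (hu.hasDerivWithinAt_grad ht).continuousWithinAt

theorem continuousOn_source (hu : IsSolution a b lam p u₀ u₁ T u) :
    ContinuousOn (source a b lam T u) (timeInterval T) := by
  have h1 := hu.continuousOn_acceleration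
  have h2 := hu.continuousOn_grad
  have h3 := hu.continuousOn_toL2
  have h4 : ContinuousOn (fun t => lapL2 (u t)) (timeInterval T) :=
    continuous_lapL2.comp_continuousOn hu.mem.continuousOn_H2
  unfold source
  fun_prop

theorem source_ae_of_pos (hu : IsSolution a b lam p u₀ u₁ T u) {t : ℝ}
    (ht : t ∈ timeInterval T) (h0 : 0 < t) :
    source a b lam T u t =ᵐ[volume.restrict Ω]
      fun x => |(u t).toH10.toL2 x| ^ (p - 1) * (u t).toH10.toL2 x := by
  filter_upwards [hu.equation t ht h0, lapL2_ae (u t),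
    Lp.coeFn_sub (acceleration T u t - (a * ‖(u t).toH10.grad‖ ^ 2 + b) • lapL2 (u t))
      (lam • (u t).toH10.toL2),
    Lp.coeFn_sub (acceleration T u t) ((a * ‖(u t).toH10.grad‖ ^ 2 + b) • lapL2 (u t)),
    Lp.coeFn_smul (a * ‖(u t).toH10.grad‖ ^ 2 + b) (lapL2 (u t)),
    Lp.coeFn_smul lam (u t).toH10.toL2] with x h1 h2 h3 h4 h5 h6
  rw [source, h3, Pi.sub_apply, h4, Pi.sub_apply, h5, h6, Pi.smul_apply, Pi.smul_apply, h2,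
    smul_eq_mul, smul_eq_mul]
  linarith

/-- The nonlinearity `|u|^{p-1} u` is square integrable and continuous in time, up to `t = 0`. -/
theorem source_ae (hu : IsSolution a b lam p u₀ u₁ T u) (hp : 1 < p) {t : ℝ}
    (ht : t ∈ timeInterval T) :
    source a b lam T u t =ᵐ[volume.restrict Ω]
      fun x => |(u t).toH10.toL2 x| ^ (p - 1) * (u t).toH10.toL2 x := by
  rcases ht.1.eq_or_lt with rfl | h0
  -- The equation is imposed only for `t > 0`; at `t = 0` it is recovered as a limit along `τ k ↓
  -- 0`.
  · obtain ⟨ε, hε, hsub⟩ := exists_Icc_subset_timeInterval hu.pos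
    set τ : ℕ → ℝ := fun k => ε * (1 / ((k : ℝ) + 1)) with hτ
    have hτpos : ∀ k, 0 < τ k := fun k => by positivity
    have hτle : ∀ k, τ k ≤ ε := fun k =>
      mul_le_of_le_one_right hε.le (by rw [div_le_one (by positivity)]; simp)
    have hτmem : ∀ k, τ k ∈ timeInterval T := fun k => hsub ⟨(hτpos k).le, hτle k⟩
    have hlim : Tendsto τ atTop (𝓝[timeInterval T] 0) := by
      refine tendsto_nhdsWithin_iff.2 ⟨?_, Eventually.of_forall hτmem⟩
      simpa [hτ] using (tendsto_one_div_add_atTop_nhds_zero_nat (𝕜 := ℝ)).const_mul ε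
    exact ae_eq_comp_of_tendsto (continuous_abs_rpow_mul hp.le)
      (Tendsto.comp (hu.continuousOn_toL2 0 ht) hlim)
      (Tendsto.comp (hu.continuousOn_source 0 ht) hlim)
      fun k => hu.source_ae_of_pos (hτmem k) (hτpos k)
  · exact hu.source_ae_of_pos ht h0

theorem integral_eq_inner (hu : IsSolution a b lam p u₀ u₁ T u) (hp : 1 < p) {t : ℝ}
    (ht : t ∈ timeInterval T) :
    ∫ x in Ω, |(u t).toH10.toL2 x| ^ (p + 1) = ⟪source a b lam T u t, (u t).toH10.toL2⟫ :=
  integral_congr_ae (integral_abs_rpow_eq_inner hp (hu.source_ae hp ht))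

theorem hasDerivWithinAt_integral (hu : IsSolution a b lam p u₀ u₁ T u) (hp : 1 < p) {t : ℝ}
    (ht : t ∈ timeInterval T) :
    HasDerivWithinAt (fun s => ∫ x in Ω, |(u s).toH10.toL2 x| ^ (p + 1))
      ((p + 1) * ⟪source a b lam T u t, (velocity T u t).toL2⟫) (timeInterval T) t :=
  hasDerivWithinAt_of_subgradient ht (by linarith) (hu.hasDerivWithinAt_toL2 ht)
    (hu.continuousOn_source t ht) fun _ hr _ hs =>
      subgradient_integral_abs_rpow hp (hu.source_ae hp hr) (hu.source_ae hp hs)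

/-- This is the equation paired with `u_t`: Green's formula turns `⟪∇u, ∇u_t⟫` into `-⟪Δu, u_t⟫`,
and `source` is by definition what cancels the rest. -/
theorem hasDerivWithinAt_energy (hu : IsSolution a b lam p u₀ u₁ T u) (hp : 1 < p) {t : ℝ}
    (ht : t ∈ timeInterval T) :
    HasDerivWithinAt (energy a b lam p T u) 0 (timeInterval T) t := by
  have hV := (hu.hasDerivWithinAt_velocity ht).norm_sq
  have hU := (hu.hasDerivWithinAt_toL2 ht).norm_sq
  have hG := (hu.hasDerivWithinAt_grad ht).norm_sq
  have hP := hu.hasDerivWithinAt_integral hp ht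
  have key := (hV.const_mul (1 / 2)).add ((((hG.pow 2).const_mul (a / 4)).add
    (hG.const_mul (b / 2))).sub (hU.const_mul (lam / 2)) |>.sub (hP.const_mul (1 / (p + 1))))
  refine (key.congr_deriv ?_).congr_of_eventuallyEq_of_mem (Eventually.of_forall fun s => ?_) ht
  · rw [inner_grad_eq, source]
    simp only [inner_sub_left, real_inner_smul_left]
    rw [real_inner_comm (acceleration T u t) (velocity T u t).toL2]
    have : p + 1 ≠ 0 := by linarith
    field_simp
    ring
  · simp only [energy, J, Pi.add_apply, Pi.sub_apply, Pi.pow_apply]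
    ring

theorem energy_zero (hu : IsSolution a b lam p u₀ u₁ T u) :
    energy a b lam p T u 0 = initialEnergy a b lam p u₀.toH10 u₁ := by
  rw [energy, hu.init, hu.init_vel, initialEnergy]

/-- Conservation of energy. -/
theorem energy_eq (hu : IsSolution a b lam p u₀ u₁ T u) (hp : 1 < p) {t : ℝ}
    (ht : t ∈ timeInterval T) :
    energy a b lam p T u t = initialEnergy a b lam p u₀.toH10 u₁ := by
  rw [← hu.energy_zero]
  have hsub : Icc 0 t ⊆ timeInterval T :=
    (timeInterval_ordConnected T).out (zero_mem_timeInterval hu.pos) ht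
  refine constant_of_derivWithin_zero
    (fun s hs => ((hu.hasDerivWithinAt_energy hp (hsub hs)).mono hsub).differentiableWithinAt)
    (fun s hs => ((hu.hasDerivWithinAt_energy hp (hsub (Ico_subset_Icc_self hs))).mono
      hsub).derivWithin ?_) t (right_mem_Icc.2 ht.1)
  exact uniqueDiffOn_Icc (hs.1.trans_lt hs.2) s (Ico_subset_Icc_self hs)

theorem hasDerivWithinAt_norm_sq (hu : IsSolution a b lam p u₀ u₁ T u) {t : ℝ}
    (ht : t ∈ timeInterval T) :
    HasDerivWithinAt (fun s => ‖(u s).toH10.toL2‖ ^ 2)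
      (2 * ⟪(u t).toH10.toL2, (velocity T u t).toL2⟫) (timeInterval T) t :=
  (hu.hasDerivWithinAt_toL2 ht).norm_sq

/-- `(‖u‖²)'' = 2 ‖u_t‖² - 2 I(u)`. -/
theorem hasDerivWithinAt_two_inner (hu : IsSolution a b lam p u₀ u₁ T u) (hp : 1 < p) {t : ℝ}
    (ht : t ∈ timeInterval T) :
    HasDerivWithinAt (fun s => 2 * ⟪(u s).toH10.toL2, (velocity T u s).toL2⟫)
      (2 * ‖(velocity T u t).toL2‖ ^ 2 - 2 * nehari a b lam p (u t).toH10)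
      (timeInterval T) t := by
  have key := ((hu.hasDerivWithinAt_toL2 ht).inner ℝ (hu.hasDerivWithinAt_velocity ht)).const_mul 2
  refine key.congr_deriv ?_
  have hA : acceleration T u t = source a b lam T u t
      + (a * ‖(u t).toH10.grad‖ ^ 2 + b) • lapL2 (u t) + lam • (u t).toH10.toL2 := by
    rw [source]; abel
  have hG := inner_grad_eq (u t) (u t).toH10
  rw [nehari, hu.integral_eq_inner hp ht, hA, inner_add_right, inner_add_right,
    real_inner_smul_right, real_inner_smul_right, real_inner_self_eq_norm_sq,
    real_inner_self_eq_norm_sq, real_inner_comm (lapL2 (u t)) _,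
    real_inner_comm (source a b lam T u t) _]
  rw [real_inner_self_eq_norm_sq] at hG
  have h1 : ⟪lapL2 (u t), (u t).toH10.toL2⟫ = -‖(u t).toH10.grad‖ ^ 2 := by rw [hG]; ring
  rw [h1]
  ring

theorem continuousOn_nehari (hu : IsSolution a b lam p u₀ u₁ T u) (hp : 1 < p) :
    ContinuousOn (fun t => nehari a b lam p (u t).toH10) (timeInterval T) := by
  have h1 := hu.continuousOn_grad
  have h2 := hu.continuousOn_toL2
  have h3 : ContinuousOn (fun s => ∫ x in Ω, |(u s).toH10.toL2 x| ^ (p + 1)) (timeInterval T) :=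
    fun t ht => (hu.hasDerivWithinAt_integral hp ht).continuousWithinAt
  unfold nehari
  fun_prop

end IsSolution

/-! ### Lower bounds for `excess` and the Nehari manifold. -/

/-- `a (p-3)/2 ‖∇v‖⁴ + (p-1) (b ‖∇v‖² - λ ‖v‖²)`, that is `2 ((p+1) J(v) - I(v))`. -/
def excess (a b lam p : ℝ) (v : H10 Ω) : ℝ :=
  a * (p - 3) / 2 * ‖v.grad‖ ^ 4 + (p - 1) * (b * ‖v.grad‖ ^ 2 - lam * ‖v.toL2‖ ^ 2)

theorem two_mul_J_sub_nehari {a b lam p : ℝ} (hp : p + 1 ≠ 0) (v : H10 Ω) :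
    2 * (p + 1) * J a b lam p v = 2 * nehari a b lam p v + excess a b lam p v := by
  rw [J, nehari, excess]
  field_simp
  ring

/-- Energy conservation trades the integral in `I` for `E(0)`. The kinetic coefficient rises from
`2` to `p + 3 > 4`, the margin that the concavity argument needs. -/
theorem IsSolution.neg_two_mul_nehari_eq {a b lam p : ℝ} {u₀ : H2H10 Ω} {u₁ : H10 Ω} {T : EReal}
    {u : ℝ → H2H10 Ω} (hu : IsSolution a b lam p u₀ u₁ T u) (hp : 1 < p) {t : ℝ}
    (ht : t ∈ timeInterval T) :
    2 * ‖(velocity T u t).toL2‖ ^ 2 - 2 * nehari a b lam p (u t).toH10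
      = (p + 3) * ‖(velocity T u t).toL2‖ ^ 2 + (excess a b lam p (u t).toH10
        - 2 * (p + 1) * initialEnergy a b lam p u₀.toH10 u₁) := by
  have h1 := hu.energy_eq hp ht
  have h2 := two_mul_J_sub_nehari (a := a) (b := b) (lam := lam) (show p + 1 ≠ 0 by linarith)
    (u t).toH10
  rw [energy] at h1
  rw [← h1]
  linarith

variable {a b lam p : ℝ}

theorem quadratic_nonneg (hb : 0 ≤ b) (hl : lam ≤ b * lambda1 Ω) (v : H10 Ω) :
    0 ≤ b * ‖v.grad‖ ^ 2 - lam * ‖v.toL2‖ ^ 2 := by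
  nlinarith [lambda1_mul_le v, mul_le_mul_of_nonneg_left (lambda1_mul_le v) hb,
    mul_le_mul_of_nonneg_right hl (sq_nonneg ‖v.toL2‖)]

theorem lambda1_sq_mul_le_excess (ha : 0 ≤ a) (hb : 0 ≤ b) (hp : 3 < p)
    (hl : lam ≤ b * lambda1 Ω) (v : H10 Ω) :
    a * (p - 3) / 2 * lambda1 Ω ^ 2 * ‖v.toL2‖ ^ 4 ≤ excess a b lam p v := by
  have h1 := quadratic_nonneg hb hl v
  have h2 : (lambda1 Ω * ‖v.toL2‖ ^ 2) ^ 2 ≤ (‖v.grad‖ ^ 2) ^ 2 :=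
    pow_le_pow_left₀ (mul_nonneg lambda1_nonneg (sq_nonneg _)) (lambda1_mul_le v) 2
  have h3 : 0 ≤ a * (p - 3) / 2 := by
    have : 0 < p - 3 := by linarith
    positivity
  have h4 := mul_le_mul_of_nonneg_left h2 h3
  have h5 := mul_nonneg (show 0 ≤ p - 1 by linarith) h1
  rw [excess]
  linarith

theorem excess_nonneg (ha : 0 ≤ a) (hb : 0 ≤ b) (hp : 3 < p) (hl : lam ≤ b * lambda1 Ω)
    (v : H10 Ω) : 0 ≤ excess a b lam p v := by
  refine le_trans ?_ (lambda1_sq_mul_le_excess ha hb hp hl v)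
  have : 0 < p - 3 := by linarith
  positivity

/-- Poincaré reduces `excess` to the parabola `a(p-3)/2 · y² - k y` in `y = ‖∇v‖²`, whose minimum is
`-h₀`. -/
theorem neg_h0_le_excess (ha : 0 < a) (hb : 0 < b) (hp : 3 < p) (h1 : 0 < lambda1 Ω)
    (hl : b * lambda1 Ω < lam) (v : H10 Ω) : -h0 Ω a b lam p ≤ excess a b lam p v := by
  have hp3 : 0 < p - 3 := by linarith
  have hlam : 0 < lam := (mul_pos hb h1).trans hl
  set y := ‖v.grad‖ ^ 2 with hy
  set k := (p - 1) * (lam - b * lambda1 Ω) / lambda1 Ω with hk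
  have e1 : lam * ‖v.toL2‖ ^ 2 ≤ lam / lambda1 Ω * y := by
    rw [div_mul_eq_mul_div, le_div_iff₀ h1]
    have := mul_le_mul_of_nonneg_left (lambda1_mul_le v) hlam.le
    linarith
  have e2 : a * (p - 3) / 2 * y ^ 2 - k * y ≤ excess a b lam p v := by
    have := mul_le_mul_of_nonneg_left e1 (show 0 ≤ p - 1 by linarith)
    have e3 : k * y = (p - 1) * (lam / lambda1 Ω * y) - (p - 1) * (b * y) := by
      rw [hk]; field_simp
    have e4 : ‖v.grad‖ ^ 4 = y ^ 2 := by rw [hy]; ring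
    rw [excess, e4, e3]
    linarith
  refine le_trans ?_ e2
  have e5 : h0 Ω a b lam p = k ^ 2 / (2 * (a * (p - 3))) := by
    rw [h0, hk]; field_simp
  have hc : 0 < a * (p - 3) := mul_pos ha hp3
  rw [e5]
  have e6 : a * (p - 3) / 2 * y ^ 2 - k * y + k ^ 2 / (2 * (a * (p - 3)))
      = (a * (p - 3) * y - k) ^ 2 / (2 * (a * (p - 3))) := by
    field_simp; ring
  have : 0 ≤ (a * (p - 3) * y - k) ^ 2 / (2 * (a * (p - 3))) := by positivity
  linarith

theorem integral_abs_rpow_smul {c q : ℝ} (hc : 0 ≤ c) (v : H10 Ω) :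
    ∫ x in Ω, |(c • v).toL2 x| ^ q = c ^ q * ∫ x in Ω, |v.toL2 x| ^ q := by
  rw [← integral_const_mul, toL2_smul]
  refine integral_congr_ae ?_
  filter_upwards [Lp.coeFn_smul c v.toL2] with x hx
  rw [hx, Pi.smul_apply, smul_eq_mul, abs_mul, abs_of_nonneg hc,
    Real.mul_rpow hc (abs_nonneg _)]

theorem nehari_smul {c : ℝ} (hc : 0 ≤ c) (v : H10 Ω) :
    nehari a b lam p (c • v) = c ^ 4 * (a * ‖v.grad‖ ^ 4)
      + c ^ 2 * (b * ‖v.grad‖ ^ 2 - lam * ‖v.toL2‖ ^ 2)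
      - c ^ (p + 1) * ∫ x in Ω, |v.toL2 x| ^ (p + 1) := by
  rw [nehari, integral_abs_rpow_smul hc, toL2_smul, grad_smul, norm_smul, norm_smul,
    Real.norm_of_nonneg hc]
  ring

theorem excess_smul_le (ha : 0 ≤ a) (hb : 0 ≤ b) (hp : 3 < p) (hl : lam ≤ b * lambda1 Ω)
    {c : ℝ} (hc : 0 ≤ c) (hc1 : c ≤ 1) (v : H10 Ω) :
    excess a b lam p (c • v) ≤ excess a b lam p v := by
  have h1 := quadratic_nonneg hb hl v
  have h2 : 0 ≤ a * (p - 3) / 2 * ‖v.grad‖ ^ 4 := by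
    have : 0 < p - 3 := by linarith
    positivity
  have h3 := mul_nonneg (show 0 ≤ p - 1 by linarith) h1
  have h4 := mul_le_of_le_one_left h2 (pow_le_one₀ hc hc1 (n := 4))
  have h5 := mul_le_of_le_one_left h3 (pow_le_one₀ hc hc1 (n := 2))
  rw [excess, excess, toL2_smul, grad_smul, norm_smul, norm_smul, Real.norm_of_nonneg hc]
  linarith

/-- Every ray through the region `I < 0` crosses the Nehari manifold before. -/
theorem exists_nehari_smul_eq_zero (ha : 0 < a) (hb : 0 ≤ b) (hp : 3 < p)
    (hl : lam ≤ b * lambda1 Ω) {v : H10 Ω} (hv : v.grad ≠ 0) (hI : nehari a b lam p v < 0) :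
    ∃ c : ℝ, 0 < c ∧ c ≤ 1 ∧ nehari a b lam p (c • v) = 0 := by
  set P := ∫ x in Ω, |v.toL2 x| ^ (p + 1) with hP
  have hB := quadratic_nonneg hb hl v
  have hA : 0 < a * ‖v.grad‖ ^ 4 := by
    have := norm_pos_iff.2 hv
    positivity
  have hAP : a * ‖v.grad‖ ^ 4 < P := by
    rw [nehari, ← hP] at hI
    linarith
  have hPpos : 0 < P := hA.trans hAP
  have hp3 : 0 < p - 3 := by linarith
  -- At this scale the quartic term and the power term of `I(c • v)` cancel, leaving the nonnegative
  -- quadratic part.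
  set c₀ := (a * ‖v.grad‖ ^ 4 / P) ^ (1 / (p - 3)) with hc₀
  have hc₀pos : 0 < c₀ := Real.rpow_pos_of_pos (div_pos hA hPpos) _
  have hc₀le : c₀ ≤ 1 :=
    Real.rpow_le_one (div_pos hA hPpos).le ((div_le_one hPpos).2 hAP.le) (by positivity)
  have hc₀pow : c₀ ^ (p + 1) = c₀ ^ 4 * (a * ‖v.grad‖ ^ 4 / P) := by
    have h1 : c₀ ^ (p - 3) = a * ‖v.grad‖ ^ 4 / P := by
      rw [hc₀, ← Real.rpow_mul (div_pos hA hPpos).le, one_div_mul_cancel hp3.ne', Real.rpow_one]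
    rw [← h1, ← Real.rpow_natCast, ← Real.rpow_add hc₀pos]
    congr 1
    push_cast
    ring
  have hcont : ContinuousOn (fun c : ℝ => nehari a b lam p (c • v)) (Icc c₀ 1) := by
    have : ContinuousOn (fun c : ℝ => c ^ 4 * (a * ‖v.grad‖ ^ 4)
        + c ^ 2 * (b * ‖v.grad‖ ^ 2 - lam * ‖v.toL2‖ ^ 2) - c ^ (p + 1) * P) (Icc c₀ 1) := by
      have h1 : Continuous fun c : ℝ => c ^ (p + 1) :=
        Real.continuous_rpow_const (by linarith)
      fun_prop
    exact this.congr fun c hc => nehari_smul (hc₀pos.le.trans hc.1) v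
  have h0 : 0 ≤ nehari a b lam p (c₀ • v) := by
    rw [nehari_smul hc₀pos.le, ← hP, hc₀pow, mul_assoc, div_mul_cancel₀ _ hPpos.ne']
    have := mul_nonneg (sq_nonneg c₀) hB
    linarith
  have h1 : nehari a b lam p ((1 : ℝ) • v) ≤ 0 := by rw [one_smul]; exact hI.le
  obtain ⟨c, hc, hc0⟩ := intermediate_value_Icc' hc₀le hcont ⟨h1, h0⟩
  exact ⟨c, hc₀pos.trans_le hc.1, hc.2, hc0⟩

/-- Where `I = 0`, `2(p+1)J` equals `excess ≥ 0`, so the set defining `d_p` is bounded below and its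
`sInf` is a true lower bound. -/
theorem wellDepth_le (ha : 0 ≤ a) (hb : 0 ≤ b) (hp : 3 < p) (hl : lam ≤ b * lambda1 Ω)
    {v : H10 Ω} (hv : v ≠ 0) (hI : nehari a b lam p v = 0) :
    wellDepth Ω a b lam p ≤ J a b lam p v := by
  refine csInf_le ⟨0, ?_⟩ ⟨v, hv, hI, rfl⟩
  rintro r ⟨w, -, hw, rfl⟩
  have h1 := two_mul_J_sub_nehari (a := a) (b := b) (lam := lam) (show p + 1 ≠ 0 by linarith) w
  have h2 := excess_nonneg ha hb hp hl w
  rw [hw] at h1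
  exact nonneg_of_mul_nonneg_right (a := 2 * (p + 1)) (by linarith) (by linarith)

/-- Shrinking `v` along its ray to the Nehari manifold does not increase `excess`, and there
`excess` equals `2(p+1)J`. -/
theorem wellDepth_mul_le_excess (ha : 0 < a) (hb : 0 ≤ b) (hp : 3 < p)
    (hl : lam ≤ b * lambda1 Ω) {v : H10 Ω} (hv : v.grad ≠ 0) (hI : nehari a b lam p v < 0) :
    2 * (p + 1) * wellDepth Ω a b lam p ≤ excess a b lam p v := by
  obtain ⟨c, hc, hc1, hc0⟩ := exists_nehari_smul_eq_zero ha hb hp hl hv hI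
  have hne : c • v ≠ 0 := smul_ne_zero hc.ne' (by rintro rfl; exact hv rfl)
  have h1 := wellDepth_le ha.le hb hp hl hne hc0
  have h2 := two_mul_J_sub_nehari (a := a) (b := b) (lam := lam) (show p + 1 ≠ 0 by linarith)
    (c • v)
  have h3 := excess_smul_le ha.le hb hp hl hc.le hc1 v
  have h4 := mul_le_mul_of_nonneg_left h1 (show 0 ≤ 2 * (p + 1) by linarith)
  linarith

/-! ### Criteria excluding global existence. -/

namespace IsSolution

variable {u₀ : H2H10 Ω} {u₁ : H10 Ω} {T : EReal} {u : ℝ → H2H10 Ω}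

theorem false_of_excess (hu : IsSolution a b lam p u₀ u₁ ⊤ u) (hp : 1 < p) {t₀ : ℝ}
    (h0 : 0 ≤ t₀)
    (h : ∀ t, t₀ ≤ t → 2 * (p + 1) * initialEnergy a b lam p u₀.toH10 u₁
      ≤ excess a b lam p (u t).toH10)
    (hpos : 0 < ⟪(u t₀).toH10.toL2, (velocity ⊤ u t₀).toL2⟫) : False := by
  have hmem : ∀ t, 0 ≤ t → t ∈ timeInterval ⊤ := fun t ht => by rwa [timeInterval_top]
  refine false_of_concavity (φ := fun s => ‖(u s).toH10.toL2‖ ^ 2)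
    (ψ := fun s => 2 * ⟪(u s).toH10.toL2, (velocity ⊤ u s).toL2⟫)
    (χ := fun t => 2 * ‖(velocity ⊤ u t).toL2‖ ^ 2 - 2 * nehari a b lam p (u t).toH10)
    -- Chosen so that `4(1 + α) = p + 3`; the `4` comes from `ψ = 2⟪u, u_t⟫`.
    (α := (p - 1) / 4) (by linarith) h0 ?_ ?_ ?_ ?_ ?_ (by linarith)
  · intro t ht
    rw [← timeInterval_top]
    exact hu.hasDerivWithinAt_norm_sq (hmem t ht)
  · intro t ht
    rw [← timeInterval_top]
    exact hu.hasDerivWithinAt_two_inner hp (hmem t ht)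
  · intro t ht
    rw [hu.neg_two_mul_nehari_eq hp (hmem t (h0.trans ht))]
    have := h t ht
    have : 0 ≤ (p + 3) * ‖(velocity ⊤ u t).toL2‖ ^ 2 := by positivity
    linarith
  · intro t ht
    rw [hu.neg_two_mul_nehari_eq hp (hmem t (h0.trans ht))]
    have h1 := h t ht
    have h2 : ⟪(u t).toH10.toL2, (velocity ⊤ u t).toL2⟫ ^ 2
        ≤ ‖(u t).toH10.toL2‖ ^ 2 * ‖(velocity ⊤ u t).toL2‖ ^ 2 := by
      rw [← mul_pow, ← sq_abs]
      exact pow_le_pow_left₀ (abs_nonneg _) (abs_real_inner_le_norm _ _) 2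
    have h3 := mul_le_mul_of_nonneg_left h2 (show 0 ≤ p + 3 by linarith)
    have h4 := mul_nonneg (sq_nonneg ‖(u t).toH10.toL2‖) (sub_nonneg.2 h1)
    linarith
  · have : (u t₀).toH10.toL2 ≠ 0 := fun h0 => by simp [h0] at hpos
    have := norm_pos_iff.2 this
    positivity

/-- The gap `δ` gives `(‖u‖²)'' ≥ δ`, so `⟪u, u_t⟫` becomes positive whatever its initial sign, and
concavity applies from then on. -/
theorem false_of_excess_of_pos (hu : IsSolution a b lam p u₀ u₁ ⊤ u) (hp : 1 < p) {δ : ℝ}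
    (hδ : 0 < δ)
    (h : ∀ t, 0 ≤ t → 2 * (p + 1) * initialEnergy a b lam p u₀.toH10 u₁ + δ
      ≤ excess a b lam p (u t).toH10) : False := by
  have hmem : ∀ t, 0 ≤ t → t ∈ timeInterval ⊤ := fun t ht => by rwa [timeInterval_top]
  set ψ : ℝ → ℝ := fun s => 2 * ⟪(u s).toH10.toL2, (velocity ⊤ u s).toL2⟫ with hψ
  have hd : ∀ t, 0 ≤ t → HasDerivWithinAt ψ
      (2 * ‖(velocity ⊤ u t).toL2‖ ^ 2 - 2 * nehari a b lam p (u t).toH10) (Ici 0) t := by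
    intro t ht
    rw [← timeInterval_top]
    exact hu.hasDerivWithinAt_two_inner hp (hmem t ht)
  set t₀ := (|ψ 0| + 1) / δ with ht₀
  have h0 : 0 ≤ t₀ := by positivity
  have hgrow := mul_sub_le_sub_of_hasDerivWithinAt (c := δ) le_rfl h0 hd fun s hs => by
    rw [hu.neg_two_mul_nehari_eq hp (hmem s hs.1.le)]
    have := h s hs.1.le
    have : 0 ≤ (p + 3) * ‖(velocity ⊤ u s).toL2‖ ^ 2 := by positivity
    linarith
  have hpos : 0 < ψ t₀ := by
    rw [sub_zero, ht₀, mul_div_cancel₀ _ hδ.ne'] at hgrow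
    have := neg_abs_le (ψ 0)
    linarith
  refine hu.false_of_excess hp h0 (fun t ht => ?_) (by simpa [hψ] using hpos)
  have := h t (h0.trans ht)
  linarith

/-- Large initial data: the bound `‖u₀‖⁴ > c E(0)` persists because `‖u‖²` increases. -/
theorem false_of_large_data (hu : IsSolution a b lam p u₀ u₁ ⊤ u) (ha : 0 < a) (hb : 0 ≤ b)
    (hp : 3 < p) (hl : lam ≤ b * lambda1 Ω)
    (hpos : 0 < ⟪u₀.toH10.toL2, u₁.toL2⟫)
    (h : 2 * (p + 1) * initialEnergy a b lam p u₀.toH10 u₁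
      ≤ a * (p - 3) / 2 * lambda1 Ω ^ 2 * ‖u₀.toH10.toL2‖ ^ 4) : False := by
  have hmem : ∀ t, 0 ≤ t → t ∈ timeInterval ⊤ := fun t ht => by rwa [timeInterval_top]
  have hp3 : 0 < p - 3 := by linarith
  set φ : ℝ → ℝ := fun s => ‖(u s).toH10.toL2‖ ^ 2 with hφ
  set ψ : ℝ → ℝ := fun s => 2 * ⟪(u s).toH10.toL2, (velocity ⊤ u s).toL2⟫ with hψ
  have hdφ : ∀ t, 0 ≤ t → HasDerivWithinAt φ (ψ t) (Ici 0) t := by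
    intro t ht
    rw [← timeInterval_top]
    exact hu.hasDerivWithinAt_norm_sq (hmem t ht)
  have hdψ : ∀ t, 0 ≤ t → HasDerivWithinAt ψ
      (2 * ‖(velocity ⊤ u t).toL2‖ ^ 2 - 2 * nehari a b lam p (u t).toH10) (Ici 0) t := by
    intro t ht
    rw [← timeInterval_top]
    exact hu.hasDerivWithinAt_two_inner (by linarith) (hmem t ht)
  have hψ0 : 0 < ψ 0 := by
    simp only [hψ, hu.init, hu.init_vel]
    linarith
  have hexc : ∀ t, 0 ≤ t → φ 0 ≤ φ t → 2 * (p + 1) * initialEnergy a b lam p u₀.toH10 u₁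
      ≤ excess a b lam p (u t).toH10 := by
    intro t ht hle
    refine h.trans (le_trans ?_ (lambda1_sq_mul_le_excess ha.le hb hp hl _))
    have h1 : ‖u₀.toH10.toL2‖ ^ 4 ≤ ‖(u t).toH10.toL2‖ ^ 4 := by
      have := pow_le_pow_left₀ (sq_nonneg _) hle 2
      simp only [hφ, hu.init] at this
      linarith
    gcongr
  have hmono : ∀ t, 0 ≤ t → (∀ s ∈ Ico 0 t, 0 < ψ s) → φ 0 ≤ φ t := by
    intro t ht hs
    have := mul_sub_le_sub_of_hasDerivWithinAt (c := 0) le_rfl ht hdφ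
      fun s hst => (hs s ⟨hst.1.le, hst.2⟩).le
    linarith
  -- The loop closes: `ψ > 0` before `t` keeps `φ ≥ φ 0`, hence the excess bound, hence `ψ' ≥ 0` and
  -- `ψ t ≥ ψ 0 > 0`.
  have hψpos := forall_pos_of_forall_Ico (fun t ht => (hdψ t ht).continuousWithinAt)
    fun t ht hs => by
      have := mul_sub_le_sub_of_hasDerivWithinAt (c := 0) le_rfl ht hdψ fun s hst => by
        rw [hu.neg_two_mul_nehari_eq (by linarith) (hmem s hst.1.le)]
        have h1 := hexc s hst.1.le (hmono s hst.1.le fun r hr => hs r ⟨hr.1, hr.2.trans hst.2⟩)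
        have : 0 ≤ (p + 3) * ‖(velocity ⊤ u s).toL2‖ ^ 2 := by positivity
        linarith
      linarith
  refine hu.false_of_excess (by linarith) le_rfl
    (fun t ht => hexc t ht (hmono t ht fun s hs => hψpos s hs.1)) ?_
  rwa [hu.init, hu.init_vel]

/-- Below the well depth the unstable set is invariant as long as `‖u‖²` increases. -/
theorem false_of_unstable (hu : IsSolution a b lam p u₀ u₁ ⊤ u) (ha : 0 < a) (hb : 0 ≤ b)
    (hp : 3 < p) (hl : lam ≤ b * lambda1 Ω) (h1 : 0 < lambda1 Ω)
    (hpos : 0 < ⟪u₀.toH10.toL2, u₁.toL2⟫) (hI : nehari a b lam p u₀.toH10 < 0)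
    (hE : initialEnergy a b lam p u₀.toH10 u₁ < wellDepth Ω a b lam p) : False := by
  have hmem : ∀ t, 0 ≤ t → t ∈ timeInterval ⊤ := fun t ht => by rwa [timeInterval_top]
  have hp1 : 1 < p := by linarith
  set φ : ℝ → ℝ := fun s => ‖(u s).toH10.toL2‖ ^ 2 with hφ
  set ψ : ℝ → ℝ := fun s => 2 * ⟪(u s).toH10.toL2, (velocity ⊤ u s).toL2⟫ with hψ
  have hdφ : ∀ t, 0 ≤ t → HasDerivWithinAt φ (ψ t) (Ici 0) t := by
    intro t ht
    rw [← timeInterval_top]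
    exact hu.hasDerivWithinAt_norm_sq (hmem t ht)
  have hdψ : ∀ t, 0 ≤ t → HasDerivWithinAt ψ
      (2 * ‖(velocity ⊤ u t).toL2‖ ^ 2 - 2 * nehari a b lam p (u t).toH10) (Ici 0) t := by
    intro t ht
    rw [← timeInterval_top]
    exact hu.hasDerivWithinAt_two_inner hp1 (hmem t ht)
  have hψ0 : 0 < ψ 0 := by
    simp only [hψ, hu.init, hu.init_vel]
    linarith
  have hφ0 : 0 < φ 0 := by
    have : (u 0).toH10.toL2 ≠ 0 := fun h0 => by simp [hψ, h0] at hψ0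
    have := norm_pos_iff.2 this
    positivity
  have hψgrow : ∀ t, 0 ≤ t → (∀ s ∈ Ico 0 t, 0 < -nehari a b lam p (u s).toH10) → 0 < ψ t := by
    intro t ht hs
    have := mul_sub_le_sub_of_hasDerivWithinAt (c := 0) le_rfl ht hdψ fun s hst => by
      have h1 := hs s ⟨hst.1.le, hst.2⟩
      have : 0 ≤ ‖(velocity ⊤ u s).toL2‖ ^ 2 := by positivity
      linarith
    linarith
  have hne : ∀ t, 0 ≤ t → (∀ s ∈ Ico 0 t, 0 < -nehari a b lam p (u s).toH10) →
      (u t).toH10.toL2 ≠ 0 := by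
    intro t ht hs h0
    have := mul_sub_le_sub_of_hasDerivWithinAt (c := 0) le_rfl ht hdφ fun s hst =>
      (hψgrow s hst.1.le fun r hr => hs r ⟨hr.1, hr.2.trans hst.2⟩).le
    have e : φ t = 0 := by simp [hφ, h0]
    linarith
  have hcont : ContinuousOn (fun t => nehari a b lam p (u t).toH10) (Ici 0) := by
    rw [← timeInterval_top]
    exact hu.continuousOn_nehari hp1
  have hneg : ∀ t, 0 ≤ t → 0 < -nehari a b lam p (u t).toH10 := by
    refine forall_pos_of_forall_Ico hcont.neg fun t ht hs => ?_
    rcases ht.eq_or_lt with rfl | htpos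
    · rw [hu.init]; linarith
    have hle : nehari a b lam p (u t).toH10 ≤ 0 := by
      have hclos : t ∈ closure (Ico 0 t) := by
        rw [closure_Ico htpos.ne]; exact right_mem_Icc.2 ht
      have hc : ContinuousWithinAt (fun t => nehari a b lam p (u t).toH10) (Ico 0 t) t :=
        (hcont t ht).mono Ico_subset_Ici_self
      have := hc.mem_closure (t := Iic 0) hclos fun s hst =>
        mem_Iic.2 (neg_pos.1 (hs s hst)).le
      rwa [isClosed_Iic.closure_eq] at this
    -- At a first time with `I = 0`, `u ≠ 0` would lie on the Nehari manifold, giving `d_p ≤ J(u) ≤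
    -- E(0) < d_p`.
    rcases hle.eq_or_lt with h0 | h0
    · have hv : (u t).toH10 ≠ 0 := fun hz => hne t ht hs (by rw [hz]; rfl)
      have e1 := wellDepth_le ha.le hb hp hl hv h0
      have e2 := hu.energy_eq hp1 (hmem t ht)
      have e3 : 0 ≤ ‖(velocity ⊤ u t).toL2‖ ^ 2 := by positivity
      rw [energy] at e2
      linarith
    · linarith
  refine hu.false_of_excess hp1 le_rfl (fun t ht => ?_) (by rwa [hu.init, hu.init_vel])
  have hI' := hneg t ht
  have hg : (u t).toH10.grad ≠ 0 := by
    intro h0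
    have e1 := lambda1_mul_le (u t).toH10
    rw [h0, norm_zero] at e1
    have e2 := norm_pos_iff.2 (hne t ht fun s hs => hneg s hs.1)
    have : 0 < lambda1 Ω * ‖(u t).toH10.toL2‖ ^ 2 := by positivity
    linarith
  have e1 := wellDepth_mul_le_excess ha hb hp hl hg (by linarith)
  have e2 := mul_le_mul_of_nonneg_left hE.le (show 0 ≤ 2 * (p + 1) by linarith)
  exact e2.trans e1

end IsSolution

/-! ### The Sobolev quotient and the lower bound on the gradient. -/

theorem sobolevConst_nonneg (q : ℝ) : 0 ≤ sobolevConst Ω q :=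
  Real.sInf_nonneg (by rintro r ⟨v, -, rfl⟩; positivity)

theorem sobolevConst_rpow_mul_le {q : ℝ} (hq : 0 < q) {v : H10 Ω} (hv : v ≠ 0)
    (hpos : 0 < ∫ x in Ω, |v.toL2 x| ^ q) :
    sobolevConst Ω q ^ (q / 2) * (∫ x in Ω, |v.toL2 x| ^ q) ≤ ‖v.grad‖ ^ q := by
  set P := ∫ x in Ω, |v.toL2 x| ^ q with hP
  have h1 : sobolevConst Ω q ≤ ‖v.grad‖ ^ 2 / lqNorm q v ^ 2 :=
    csInf_le ⟨0, by rintro r ⟨w, -, rfl⟩; positivity⟩ ⟨v, hv, rfl⟩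
  have hn : 0 < lqNorm q v := Real.rpow_pos_of_pos hpos _
  rw [le_div_iff₀ (by positivity)] at h1
  have h2 := Real.rpow_le_rpow (mul_nonneg (sobolevConst_nonneg q) (sq_nonneg _)) h1
    (show 0 ≤ q / 2 by positivity)
  rw [Real.mul_rpow (sobolevConst_nonneg q) (sq_nonneg _), ← Real.rpow_natCast,
    ← Real.rpow_natCast, ← Real.rpow_mul hn.le, ← Real.rpow_mul (norm_nonneg _)] at h2
  have e : ((2 : ℕ) : ℝ) * (q / 2) = q := by push_cast; ring
  have e2 : lqNorm q v ^ q = P := by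
    rw [lqNorm, ← hP, ← Real.rpow_mul hpos.le, one_div_mul_cancel hq.ne', Real.rpow_one]
  rwa [e, e2] at h2

/-- Nonpositive energy forces the gradient to vanish or to be large. -/
theorem le_norm_grad_of_J_nonpos (ha : 0 < a) (hb : 0 ≤ b) (hp : 3 < p)
    (hl : lam ≤ b * lambda1 Ω) {v : H10 Ω} (hJ : J a b lam p v ≤ 0) (hv : 0 < ‖v.grad‖) :
    ((p + 1) / 4 * a * sobolevConst Ω (p + 1) ^ ((p + 1) / 2)) ^ (1 / (p - 3)) ≤ ‖v.grad‖ := by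
  have hB := quadratic_nonneg hb hl v
  set P := ∫ x in Ω, |v.toL2 x| ^ (p + 1) with hP
  have hp1 : 0 < p + 1 := by linarith
  have hp3 : 0 < p - 3 := by linarith
  -- `J ≤ 0` with its nonnegative quadratic part dropped. This also yields `P > 0`, needed to clear
  -- the Sobolev quotient.
  have h1 : (p + 1) / 4 * a * ‖v.grad‖ ^ 4 ≤ P := by
    rw [J, ← hP] at hJ
    have : a / 4 * ‖v.grad‖ ^ 4 ≤ P / (p + 1) := by
      rw [div_eq_mul_one_div P, mul_comm P]
      linarith
    rw [le_div_iff₀ hp1] at this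
    linarith
  have hPpos : 0 < P := lt_of_lt_of_le (by positivity) h1
  have hne : v ≠ 0 := by
    rintro rfl
    exact hv.ne' (by rw [show (0 : H10 Ω).grad = 0 from rfl, norm_zero])
  have h2 := sobolevConst_rpow_mul_le hp1 hne hPpos
  have hS : 0 ≤ sobolevConst Ω (p + 1) ^ ((p + 1) / 2) :=
    Real.rpow_nonneg (sobolevConst_nonneg _) _
  have h3 := (mul_le_mul_of_nonneg_left h1 hS).trans h2
  have h4 : ‖v.grad‖ ^ (p + 1) = ‖v.grad‖ ^ (p - 3) * ‖v.grad‖ ^ 4 := by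
    rw [← Real.rpow_natCast, ← Real.rpow_add hv]
    congr 1
    push_cast
    ring
  have h5 : (p + 1) / 4 * a * sobolevConst Ω (p + 1) ^ ((p + 1) / 2) ≤ ‖v.grad‖ ^ (p - 3) := by
    refine le_of_mul_le_mul_right ?_ (pow_pos hv 4)
    rw [← h4]
    linarith
  calc _ ≤ (‖v.grad‖ ^ (p - 3)) ^ (1 / (p - 3)) :=
        Real.rpow_le_rpow (by positivity) h5 (by positivity)
    _ = ‖v.grad‖ := by
        rw [← Real.rpow_mul hv.le, mul_one_div_cancel hp3.ne', Real.rpow_one]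

/-- The vacuum region. -/
theorem IsSolution.le_norm_grad {u₀ : H2H10 Ω} {u₁ : H10 Ω} {T : EReal} {u : ℝ → H2H10 Ω}
    (hu : IsSolution a b lam p u₀ u₁ T u) (ha : 0 < a) (hb : 0 ≤ b)
    (hp : 3 < p) (hl : lam ≤ b * lambda1 Ω)
    (hE : initialEnergy a b lam p u₀.toH10 u₁ ≤ 0) (h0 : 0 < ‖u₀.toH10.grad‖) {t : ℝ}
    (ht : t ∈ timeInterval T) :
    ((p + 1) / 4 * a * sobolevConst Ω (p + 1) ^ ((p + 1) / 2)) ^ (1 / (p - 3))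
      ≤ ‖(u t).toH10.grad‖ := by
  set K := ((p + 1) / 4 * a * sobolevConst Ω (p + 1) ^ ((p + 1) / 2)) ^ (1 / (p - 3))
  have hdich : ∀ s ∈ timeInterval T, 0 < ‖(u s).toH10.grad‖ → K ≤ ‖(u s).toH10.grad‖ := by
    intro s hs hpos
    refine le_norm_grad_of_J_nonpos ha hb hp hl ?_ hpos
    have h1 := hu.energy_eq (by linarith) hs
    have h2 : 0 ≤ ‖(velocity T u s).toL2‖ ^ 2 := by positivity
    rw [energy] at h1
    linarith
  by_contra! hlt
  have hzero : ‖(u t).toH10.grad‖ = 0 := by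
    by_contra hne
    exact absurd (hdich t ht (lt_of_le_of_ne (norm_nonneg _) (Ne.symm hne))) (not_le.2 hlt)
  have hmem0 := zero_mem_timeInterval hu.pos
  -- Positivity of `K` comes from the supposed failure itself, not from positivity of the Sobolev
  -- constant.
  have hK : 0 < K := hzero ▸ hlt
  have hK0 : K ≤ ‖(u 0).toH10.grad‖ := hdich 0 hmem0 (by rwa [hu.init])
  have hsub : Icc 0 t ⊆ timeInterval T := (timeInterval_ordConnected T).out hmem0 ht
  -- Passing from at least `K` to `0`, the norm takes the value `K / 2`, which the dichotomy
  -- forbids.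
  obtain ⟨s, hs, hsK⟩ := intermediate_value_Icc' ht.1 (hu.continuousOn_grad.norm.mono hsub)
    (show K / 2 ∈ Icc ‖(u t).toH10.grad‖ ‖(u 0).toH10.grad‖ by
      rw [hzero]; constructor <;> linarith)
  simp only at hsK
  have := hdich s (hsub hs) (by rw [hsK]; linarith)
  linarith

theorem integral_mul_eq_inner (f g : L2 Ω) : ∫ x in Ω, f x * g x = ⟪f, g⟫ := by
  rw [L2.inner_def]
  exact integral_congr_ae (Eventually.of_forall fun x => by simp [mul_comm])

/-- Negative energy thus forces `u₀ ≠ 0`, and hence `λ₁ > 0`, when no sign of `∫ u₀u₁` is given. -/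
theorem initialEnergy_nonneg_of_toL2_eq_zero (ha : 0 ≤ a) (hb : 0 ≤ b) (hp : 0 < p)
    {u₀ u₁ : H10 Ω} (h : u₀.toL2 = 0) : 0 ≤ initialEnergy a b lam p u₀ u₁ := by
  have hint : ∫ x in Ω, |u₀.toL2 x| ^ (p + 1) = 0 := by
    refine integral_eq_zero_of_ae ?_
    rw [h]
    filter_upwards [Lp.coeFn_zero ℝ 2 (volume.restrict Ω)] with x hx
    rw [hx]
    simp [Real.zero_rpow (show p + 1 ≠ 0 by linarith)]
  rw [initialEnergy, J, hint, h, norm_zero]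
  have : 0 ≤ 1 / 2 * ‖u₁.toL2‖ ^ 2 + (a / 4 * ‖u₀.grad‖ ^ 4 + b / 2 * ‖u₀.grad‖ ^ 2) := by
    positivity
  linarith

end Kirchhoff

end

/-! ### The cases of the theorem. -/

theorem theorem2p10 (Ω : Set Kirchhoff.E3) (hΩ : Kirchhoff.IsSmoothBoundedDomain Ω)
    (a b lam p : ℝ) (ha : 0 < a) (hb : 0 < b) (hp : 3 < p)
    (u₀ : Kirchhoff.H2H10 Ω) (u₁ : Kirchhoff.H10 Ω)
    (Tmax : EReal) (u : ℝ → Kirchhoff.H2H10 Ω)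
    (hu : Kirchhoff.IsMaximalSolution a b lam p u₀ u₁ Tmax u)
    (E₀ : ℝ) (hE₀ : E₀ = Kirchhoff.initialEnergy a b lam p u₀.toH10 u₁)
    (m : ℝ) (hm : m = ∫ x in Ω, u₀.toH10.toL2 x * u₁.toL2 x) :
    -- finite maximal existence time, for `λ ≤ b λ₁`
    (lam ≤ b * Kirchhoff.lambda1 Ω →
      (E₀ < 0 ∨
        (E₀ = 0 ∧ 0 < m) ∨
        (p < 5 ∧ 0 < E₀ ∧ E₀ < Kirchhoff.wellDepth Ω a b lam p ∧ 0 < m ∧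
          u₀.toH10 ∈ Kirchhoff.unstableSet Ω a b lam p) ∨
        (0 < E₀ ∧ 0 < m ∧
          ‖u₀.toH10.toL2‖ ^ 4
            > 4 * (p + 1) / ((p - 3) * a * Kirchhoff.lambda1 Ω ^ 2) * E₀)) →
      Tmax < ⊤) ∧
    -- finite maximal existence time, for `λ > b λ₁`
    (lam > b * Kirchhoff.lambda1 Ω →
      (E₀ < - Kirchhoff.h0 Ω a b lam p / (2 * p + 2) ∨
        (E₀ = - Kirchhoff.h0 Ω a b lam p / (2 * p + 2) ∧ 0 < m)) →
      Tmax < ⊤) ∧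
    -- vacuum region
    (p < 5 → lam ≤ b * Kirchhoff.lambda1 Ω → E₀ ≤ 0 → 0 < ‖u₀.toH10.grad‖ →
      ∀ t ∈ Kirchhoff.timeInterval Tmax,
        ((p + 1) / 4 * a * Kirchhoff.sobolevConst Ω (p + 1) ^ ((p + 1) / 2)) ^ (1 / (p - 3))
          ≤ ‖(u t).toH10.grad‖) := by
  have hsol := hu.solution
  have hp1 : 1 < p := by linarith
  have hp3 : 0 < p - 3 := by linarith
  rw [Kirchhoff.integral_mul_eq_inner] at hm
  have hinner : inner ℝ (u 0).toH10.toL2 (Kirchhoff.velocity Tmax u 0).toL2 = m := by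
    rw [hsol.init, hsol.init_vel, hm]
  have hlam1 : 0 < m → 0 < Kirchhoff.lambda1 Ω := fun h =>
    Kirchhoff.lambda1_pos hΩ.isBounded (v := u₀.toH10) fun h0 => by
      rw [hm, h0, inner_zero_left] at h
      exact lt_irrefl _ h
  refine ⟨fun hl hcases => ?_, fun hl hcases => ?_, fun _ hl hE h0 t ht =>
    hsol.le_norm_grad ha hb.le hp hl (hE₀ ▸ hE) h0 ht⟩
  · by_contra hT
    obtain rfl := not_lt_top_iff.1 hT
    have hexc := Kirchhoff.excess_nonneg ha.le hb.le hp hl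
    rcases hcases with h | ⟨h, h'⟩ | ⟨-, -, h, h', h''⟩ | ⟨-, h', h⟩
    · have hneg : 0 < -(2 * (p + 1) * E₀) := by nlinarith
      refine hsol.false_of_excess_of_pos hp1 hneg fun t _ => ?_
      rw [← hE₀]
      linarith [hexc (u t).toH10]
    · refine hsol.false_of_excess hp1 le_rfl (fun t _ => ?_) (hinner ▸ h')
      rw [← hE₀, h]
      linarith [hexc (u t).toH10]
    · exact hsol.false_of_unstable ha hb.le hp hl (hlam1 h') (hm ▸ h') h''.2 (hE₀ ▸ h)
    · refine hsol.false_of_large_data ha hb.le hp hl (hm ▸ h') ?_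
      have hl1 := hlam1 h'
      rw [← hE₀]
      -- Clearing this denominator turns the data threshold into `2(p+1)E(0) < a(p-3)/2 · λ₁²
      -- ‖u₀‖⁴`.
      have hc : 0 < (p - 3) * a * Kirchhoff.lambda1 Ω ^ 2 := by positivity
      rw [gt_iff_lt, div_mul_eq_mul_div, div_lt_iff₀ hc] at h
      linarith
  · by_contra hT
    obtain rfl := not_lt_top_iff.1 hT
    have hh0 : 0 ≤ Kirchhoff.h0 Ω a b lam p := by
      rw [Kirchhoff.h0]
      positivity
    have hp2 : 0 < 2 * p + 2 := by linarith
    rcases hcases with h | ⟨h, h'⟩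
    · have hne : u₀.toH10.toL2 ≠ 0 := fun h0 => by
        have h1 := Kirchhoff.initialEnergy_nonneg_of_toL2_eq_zero (lam := lam) (u₁ := u₁)
          ha.le hb.le (show 0 < p by linarith) h0
        have h2 : -Kirchhoff.h0 Ω a b lam p / (2 * p + 2) ≤ 0 :=
          div_nonpos_of_nonpos_of_nonneg (by linarith) hp2.le
        linarith
      have hexc := Kirchhoff.neg_h0_le_excess ha hb hp
        (Kirchhoff.lambda1_pos hΩ.isBounded hne) hl
      rw [lt_div_iff₀ hp2] at h
      refine hsol.false_of_excess_of_pos hp1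
        (show 0 < -Kirchhoff.h0 Ω a b lam p - E₀ * (2 * p + 2) by linarith) fun t _ => ?_
      rw [← hE₀]
      linarith [hexc (u t).toH10]
    · have hexc := Kirchhoff.neg_h0_le_excess ha hb hp (hlam1 h') hl
      rw [eq_div_iff hp2.ne'] at h
      refine hsol.false_of_excess hp1 le_rfl (fun t _ => ?_) (hinner ▸ h')
      rw [← hE₀]
      linarith [hexc (u t).toH10]
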